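/- Let $K$ be a field and let $S = K[z_1,\ldots,z_r]$ be a polynomial ring with its standard grading. For a finitely generated graded $S$-module $M$, its Hilbert depth $\operatorname{hdepth}(M)$ is the maximal depth (with respect to the ideal generated by the variables) of a finitely generated graded $S$-module $N$ with the same Hilbert series as $M$. For an integer $n\ge 1$, let $S_{n,n}=K[x_1,\ldots,x_n,y_1,\ldots,y_n]$, let $I_{n,n}=(x_iy_j : 1\le i\le n,\ 1\le j\le n)\subset S_{n,n}$ be the edge ideal of the complete bipartite graph $K_{n,n}$, and put $h(n,n)=\operatorname{hdepth}(S_{n,n}/I_{n,n})$. **Theorem.** For every $n\ge 2$, $$\left\lfloor \frac n2+\sqrt{\left\lfloor \frac n2\right\rfloor \ln 2}\,\right\rfloor-1\ \le\ h(n,n)\ \le\ \left\lfloor \frac{n+1}2+\sqrt{\left\lfloor \frac n2\right\rfloor \ln 2}\,\right\rfloor .$$ -/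

import Mathlib

universe u v w

namespace HilbertDepth

section General

variable (σ : Type v) (K : Type u) [Field K]

/-- The depth of a module `M` over the polynomial ring `S = K[X_i : i ∈ σ]`: the supremum of the
lengths of the `M`-regular sequences contained in the ideal generated by all the variables. -/
noncomputable def depth (M : Type w) [AddCommGroup M] [Module (MvPolynomial σ K) M] : ℕ∞ :=
  sSup {d : ℕ∞ | ∃ rs : List (MvPolynomial σ K),
    (∀ r ∈ rs, r ∈ MvPolynomial.idealOfVars σ K) ∧
    RingTheory.Sequence.IsRegular M rs ∧ d = (rs.length : ℕ∞)}

variable {K} in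
/-- `ℳ` is a `ℤ`-grading of the `S`-module `M`, where `S = K[X_i : i ∈ σ]` carries its standard
grading (every variable has degree one): `M` is the internal direct sum of the `ℳ i`, and
`S_d ℳ_i ⊆ ℳ_{i+d}`. -/
structure IsGrading {M : Type w} [AddCommGroup M] [Module K M] [Module (MvPolynomial σ K) M]
    (ℳ : ℤ → Submodule K M) : Prop where
  isInternal : DirectSum.IsInternal ℳ
  smul_mem : ∀ (d : ℕ) (i : ℤ) (p : MvPolynomial σ K) (x : M),
    p ∈ MvPolynomial.homogeneousSubmodule σ K d → x ∈ ℳ i → p • x ∈ ℳ (i + d)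

variable {K} in
/-- The Hilbert function of a graded module: `i ↦ dim_K ℳ_i`. Two graded modules have the same
Hilbert series if and only if they have the same Hilbert function. -/
noncomputable def hilbertFunction {M : Type w} [AddCommGroup M] [Module K M]
    (ℳ : ℤ → Submodule K M) (i : ℤ) : ℕ :=
  Module.finrank K (ℳ i)

variable {K} in
/-- The Hilbert depth of a graded `S`-module with graded pieces `ℳ`: the supremum of the depths of
the finitely generated graded `S`-modules with the same Hilbert series. -/
noncomputable def hilbertDepth {M : Type w} [AddCommGroup M] [Module K M]
    (ℳ : ℤ → Submodule K M) : ℕ∞ :=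
  sSup {d : ℕ∞ | ∃ (N : Type (max u v)) (_ : AddCommGroup N) (_ : Module K N)
    (_ : Module (MvPolynomial σ K) N) (_ : IsScalarTower K (MvPolynomial σ K) N)
    (𝒩 : ℤ → Submodule K N),
    Module.Finite (MvPolynomial σ K) N ∧ IsGrading σ 𝒩 ∧
    hilbertFunction 𝒩 = hilbertFunction ℳ ∧ d = depth σ K N}

variable {σ K} in
/-- The graded pieces of `S ⧸ I`: the piece of degree `d ≥ 0` is the image of the space of
homogeneous polynomials of degree `d`, and the pieces of negative degree are zero. -/
noncomputable def quotientGrading (I : Ideal (MvPolynomial σ K)) :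
    ℤ → Submodule K (MvPolynomial σ K ⧸ I)
  | Int.ofNat d =>
      (MvPolynomial.homogeneousSubmodule σ K d).map (Ideal.Quotient.mkₐ K I).toLinearMap
  | Int.negSucc _ => ⊥

end General

/-- The edge ideal `I_{n,m} = (x_i y_j : 1 ≤ i ≤ n, 1 ≤ j ≤ m)` of the complete bipartite graph
`K_{n,m}` in `K[x_1, …, x_n, y_1, …, y_m]`; the variable `x_i` is indexed by `Sum.inl i` and `y_j`
by `Sum.inr j`. -/
noncomputable def bipartiteEdgeIdeal (K : Type u) [Field K] (n m : ℕ) :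
    Ideal (MvPolynomial (Fin n ⊕ Fin m) K) :=
  Ideal.span {p | ∃ (i : Fin n) (j : Fin m),
    p = MvPolynomial.X (Sum.inl i) * MvPolynomial.X (Sum.inr j)}

/-- `h(n,m)`, the Hilbert depth of `S_{n,m} ⧸ I_{n,m}`. -/
noncomputable def h (K : Type u) [Field K] (n m : ℕ) : ℕ∞ :=
  hilbertDepth (Fin n ⊕ Fin m) (quotientGrading (bipartiteEdgeIdeal K n m))

end HilbertDepth

/-! Modulo the edge ideal a polynomial amounts to its restrictions to y = 0 and to x = 0, which
share only the constant term. Hence the Hilbert series of the quotient is 2/(1-t)^n - 1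
(`hilbertFunction_quotientGrading`). Multiplying it by (1-t)^d, that is, taking d-th backward
differences, gives for d ≤ n the coefficients 2·multichoose(n-d, k) - (-1)^k·choose(d, k). Both
bounds depend on the signs of these numbers.

Upper bound: a finitely generated graded module with a regular sequence of length d has nonnegative
d-th differences (`HasRegularSeq.iterate_backwardDiff_nonneg`). The sequence need not be
homogeneous. After passing to an infinite field its elements are exchanged for linear forms
(`HasRegularSeq.quotSMulTop`), and each linear form contributes one difference.

Lower bound: if choose(d, k) ≤ 2·multichoose(n-d, k) for all k, the series is that of a finite
direct sum of shifted polynomial rings in between d and n variables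
(`two_mul_polyHilbert_sub_mem_freeHilbert`). Such a sum is a module on which x_1, …, x_d is regular
(`isRealized_of_mem_freeHilbert`).

Numerically, put m = n/2 and s = d - m. After multiplication by k! the comparison is between ∏(m +
(s-i)) and 2∏(m - (s-i)) over i < k. The logarithm of the ratio of the products is about Σ 2(s-i)/m,
with maximum about s²/m near k = s, so the threshold is s ≈ √(m log 2). The lemmas
`choose_le_two_mul_multichoose` and `exists_even_two_mul_multichoose_lt_choose` make this precise on
the two sides. -/

namespace HilbertDepth

/-! ### Exchanging elements of regular sequences. -/

section Exchange

open RingTheory.Sequence Pointwise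

variable {R : Type*} [CommRing R]

/-- `M` has a weakly regular sequence of length `d` with entries in the ideal `𝔪`. -/
def HasRegularSeq (𝔪 : Ideal R) (M : Type*) [AddCommGroup M] [Module R M] (d : ℕ) : Prop :=
  ∃ rs : List R, rs.length = d ∧ (∀ r ∈ rs, r ∈ 𝔪) ∧ IsWeaklyRegular M rs

variable {𝔪 : Ideal R}

lemma hasRegularSeq_succ_iff {M : Type*} [AddCommGroup M] [Module R M] {d : ℕ} :
    HasRegularSeq 𝔪 M (d + 1) ↔
      ∃ r ∈ 𝔪, IsSMulRegular M r ∧ HasRegularSeq 𝔪 (QuotSMulTop r M) d := by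
  constructor
  · rintro ⟨rs, hl, hm, hr⟩
    obtain ⟨r, rs, rfl⟩ := List.exists_cons_of_length_eq_add_one hl
    rw [isWeaklyRegular_cons_iff] at hr
    simp only [List.mem_cons, forall_eq_or_imp] at hm
    exact ⟨r, hm.1, hr.1, rs, by simpa using hl, hm.2, hr.2⟩
  · rintro ⟨r, hr, hreg, rs, hl, hm, hrs⟩
    exact ⟨r :: rs, by simpa using hl, by simpa using ⟨hr, hm⟩,
      (isWeaklyRegular_cons_iff M r rs).2 ⟨hreg, hrs⟩⟩

lemma HasRegularSeq.congr {M M' : Type*} [AddCommGroup M] [Module R M] [AddCommGroup M']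
    [Module R M'] (e : M ≃ₗ[R] M') {d : ℕ} (h : HasRegularSeq 𝔪 M d) : HasRegularSeq 𝔪 M' d := by
  obtain ⟨rs, hl, hm, hr⟩ := h
  exact ⟨rs, hl, hm, (e.isWeaklyRegular_congr rs).1 hr⟩

lemma isSMulRegular_quotSMulTop_iff {M : Type*} [AddCommGroup M] [Module R M] {r g : R} :
    IsSMulRegular (QuotSMulTop r M) g ↔ ∀ x y : M, g • x = r • y → ∃ z, x = r • z := by
  rw [isSMulRegular_iff_right_eq_zero_of_smul]
  constructor
  · intro h x y hxy
    have := h (Submodule.Quotient.mk x) (by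
      rw [← Submodule.Quotient.mk_smul, Submodule.Quotient.mk_eq_zero, hxy]
      exact Submodule.smul_mem_pointwise_smul _ _ _ trivial)
    rw [Submodule.Quotient.mk_eq_zero] at this
    obtain ⟨z, -, hz⟩ := this
    exact ⟨z, hz.symm⟩
  · intro h m hm
    obtain ⟨x, rfl⟩ := Submodule.Quotient.mk_surjective _ m
    rw [← Submodule.Quotient.mk_smul, Submodule.Quotient.mk_eq_zero] at hm
    obtain ⟨y, -, hy⟩ := hm
    obtain ⟨z, rfl⟩ := h x y hy.symm
    rw [Submodule.Quotient.mk_eq_zero]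
    exact Submodule.smul_mem_pointwise_smul _ _ _ trivial

/-- This half of the permutability of regular sequences needs no local or graded hypothesis.
Regularity of `g` on `M` itself is the half that does. -/
lemma _root_.IsSMulRegular.quotSMulTop_swap {M : Type*} [AddCommGroup M] [Module R M] {r g : R}
    (hr : IsSMulRegular M r) (h : IsSMulRegular (QuotSMulTop r M) g) :
    IsSMulRegular (QuotSMulTop g M) r := by
  rw [isSMulRegular_quotSMulTop_iff] at h ⊢
  intro x y hxy
  obtain ⟨z, rfl⟩ := h y x hxy.symm
  refine ⟨z, hr ?_⟩
  simp only [hxy, smul_comm r g]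

/-- Quotients by two elements can be taken in either order. -/
noncomputable def quotSMulTopComm (M : Type*) [AddCommGroup M] [Module R M] (r g : R) :
    QuotSMulTop g (QuotSMulTop r M) ≃ₗ[R] QuotSMulTop r (QuotSMulTop g M) :=
  Submodule.quotEquivOfEq _ _
      (by rw [Submodule.map_pointwise_smul, Submodule.map_top, Submodule.range_mkQ]) ≪≫ₗ
    Submodule.quotientQuotientEquivQuotientSup (r • (⊤ : Submodule R M)) (g • ⊤) ≪≫ₗ
    Submodule.quotEquivOfEq _ _ (sup_comm _ _) ≪≫ₗ
    (Submodule.quotientQuotientEquivQuotientSup (g • (⊤ : Submodule R M)) (r • ⊤)).symm ≪≫ₗ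
    Submodule.quotEquivOfEq _ _
      (by rw [Submodule.map_pointwise_smul, Submodule.map_top, Submodule.range_mkQ])

lemma HasRegularSeq.quotSMulTop_comm {M : Type*} [AddCommGroup M] [Module R M] {r g : R} {d : ℕ}
    (h : HasRegularSeq 𝔪 (QuotSMulTop g (QuotSMulTop r M)) d) :
    HasRegularSeq 𝔪 (QuotSMulTop r (QuotSMulTop g M)) d :=
  h.congr (quotSMulTopComm M r g)

variable {L : Type*} [Field L] [Infinite L] [Algebra L R] [IsNoetherianRing R]

/-- Prime avoidance by subspaces: over an infinite field, if no nonzero element of `M` is killed by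
the maximal ideal `𝔪`, a subspace generating `𝔪` contains an `M`-regular element. -/
lemma exists_isSMulRegular_mem_submodule [h𝔪 : 𝔪.IsMaximal] {V : Submodule L R}
    (hV : Ideal.span (V : Set R) = 𝔪) (M : Type*) [AddCommGroup M] [Module R M] [Module.Finite R M]
    (h : ∀ x : M, (∀ r ∈ 𝔪, r • x = 0) → x = 0) : ∃ l ∈ V, IsSMulRegular M l := by
  by_contra! hcon
  have hfin := associatedPrimes.finite R M
  have : Finite (associatedPrimes R M) := hfin
  -- A vector space over an infinite field is not a finite union of proper subspaces, so a `V`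
  -- consisting of zero divisors lies in a single associated prime.
  obtain ⟨⟨P, hP⟩, hPt⟩ := Subspace.exists_eq_top_of_iUnion_eq_univ
    (p := fun P : associatedPrimes R M ↦
      ((P : Ideal R).restrictScalars L).comap V.subtype) (by
      rw [Set.eq_univ_iff_forall]
      rintro ⟨l, hl⟩
      have hnr := hcon l hl
      rw [isSMulRegular_iff_right_eq_zero_of_smul] at hnr
      push Not at hnr
      obtain ⟨x, hx, hx0⟩ := hnr
      have : l ∈ ⋃ p ∈ associatedPrimes R M, (p : Set R) := by
        rw [biUnion_associatedPrimes_eq_zero_divisors]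
        exact ⟨x, hx0, hx⟩
      simp only [Set.mem_iUnion] at this ⊢
      obtain ⟨p, hp, hlp⟩ := this
      exact ⟨⟨p, hp⟩, hlp⟩)
  have hle : 𝔪 ≤ P := by
    rw [← hV, Ideal.span_le]
    intro l hl
    have : (⟨l, hl⟩ : V) ∈ ((P : Ideal R).restrictScalars L).comap V.subtype := by
      rw [hPt]; trivial
    exact this
  have hPm : 𝔪 = P := h𝔪.eq_of_le hP.isPrime.ne_top hle
  obtain ⟨-, x, hx⟩ := isAssociatedPrime_iff.1 (AssociatedPrimes.mem_iff.1 hP)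
  have hmem : ∀ r : R, r ∈ P ↔ r • x = 0 := fun r ↦ by
    rw [hx, Submodule.mem_colon_singleton, Submodule.mem_bot]
  have hx0 : x = 0 := h x fun r hr ↦ (hmem r).1 (hPm ▸ hr)
  exact hP.isPrime.ne_top ((Ideal.eq_top_iff_one _).2 ((hmem 1).2 (by rw [hx0, smul_zero])))

/-- The length of a regular sequence in `𝔪` drops by at most one modulo any `M`-regular element
of `𝔪`. -/
theorem HasRegularSeq.quotSMulTop [h𝔪 : 𝔪.IsMaximal] {V : Submodule L R}
    (hV : Ideal.span (V : Set R) = 𝔪) {d : ℕ} :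
    ∀ (M : Type w) [AddCommGroup M] [Module R M] [Module.Finite R M],
      HasRegularSeq 𝔪 M (d + 1) → ∀ f ∈ 𝔪, IsSMulRegular M f →
        HasRegularSeq 𝔪 (QuotSMulTop f M) d := by
  induction d with
  | zero => exact fun M _ _ _ _ f _ _ ↦ ⟨[], rfl, by simp, .nil R _⟩
  | succ d ih =>
    intro M _ _ _ h f hf hfM
    obtain ⟨r, hr, hrM, hrest⟩ := hasRegularSeq_succ_iff.1 h
    obtain ⟨s, hs, hsM, -⟩ := hasRegularSeq_succ_iff.1 hrest
    -- Avoidance on the product yields one `g` regular on `M`, `M/rM` and `M/fM` at once. The third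
    -- factor has no nonzero element killed by `𝔪` because `M` has the regular sequence `r, s`.
    obtain ⟨g, hgV, hg⟩ := exists_isSMulRegular_mem_submodule hV
        (M × QuotSMulTop r M × QuotSMulTop f M) (by
      rintro ⟨a, b, c⟩ habc
      have ha : ∀ t ∈ 𝔪, t • a = 0 := fun t ht ↦ congrArg (·.1) (habc t ht)
      have hb : ∀ t ∈ 𝔪, t • b = 0 := fun t ht ↦ congrArg (·.2.1) (habc t ht)
      have hc : ∀ t ∈ 𝔪, t • c = 0 := fun t ht ↦ congrArg (·.2.2) (habc t ht)
      refine Prod.ext (hrM.right_eq_zero_of_smul (ha r hr))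
        (Prod.ext (hsM.right_eq_zero_of_smul (hb s hs)) ?_)
      obtain ⟨x, rfl⟩ := Submodule.Quotient.mk_surjective _ c
      have hx : ∀ t ∈ 𝔪, ∃ y : M, t • x = f • y := by
        intro t ht
        have := hc t ht
        rw [← Submodule.Quotient.mk_smul, Submodule.Quotient.mk_eq_zero] at this
        obtain ⟨y, -, hy⟩ := this
        exact ⟨y, hy.symm⟩
      -- From r x = f y, regularity of `s` modulo `r` gives y = r z, and cancelling `r` gives x = f
      -- z.
      obtain ⟨y, hy⟩ := hx r hr
      have hsy : s • y ∈ r • (⊤ : Submodule R M) := by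
        obtain ⟨b, hb⟩ := hx s hs
        refine ⟨b, trivial, hfM ?_⟩
        change f • r • b = f • s • y
        rw [smul_comm f s, ← hy, smul_comm s r, hb, smul_comm f r]
      obtain ⟨b, -, hb⟩ := hsy
      obtain ⟨z, rfl⟩ := isSMulRegular_quotSMulTop_iff.1 hsM y b hb.symm
      have hxz : x = f • z := hrM (by simp only [hy, smul_comm f r])
      change Submodule.Quotient.mk x = 0
      rw [Submodule.Quotient.mk_eq_zero, hxz]
      exact Submodule.smul_mem_pointwise_smul _ _ _ trivial)
    have hg𝔪 : g ∈ 𝔪 := hV ▸ Ideal.subset_span hgV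
    have hgM : IsSMulRegular M g := hg.of_injective (LinearMap.inl R M _) LinearMap.inl_injective
    have hg2 := hg.of_injective (LinearMap.inr R M _) LinearMap.inr_injective
    have hgr : IsSMulRegular (QuotSMulTop r M) g :=
      hg2.of_injective (LinearMap.inl R _ _) LinearMap.inl_injective
    have hgf : IsSMulRegular (QuotSMulTop f M) g :=
      hg2.of_injective (LinearMap.inr R _ _) LinearMap.inr_injective
    -- Induction is used twice: on `M/rM` with `g`, which gives `M/gM` length d + 1, and then on
    -- `M/gM` with `f`. Interchanging the quotients puts `g` at the head of a sequence on `M/fM`.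
    have h1 : HasRegularSeq 𝔪 (QuotSMulTop g M) (d + 1) :=
      hasRegularSeq_succ_iff.2 ⟨r, hr, hrM.quotSMulTop_swap hgr,
        (ih _ hrest g hg𝔪 hgr).quotSMulTop_comm⟩
    exact hasRegularSeq_succ_iff.2 ⟨g, hg𝔪, hgf,
      (ih _ h1 f hf (hfM.quotSMulTop_swap hgf)).quotSMulTop_comm⟩

end Exchange

/-! ### Internal gradings described by projections. -/

section Projections

open RingTheory.Sequence Pointwise

variable {K : Type*} [Field K] {M : Type*} [AddCommGroup M] [Module K M]

/-- The maps `π i` are the projections onto the pieces `ℳ i` of a decomposition of a module. -/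
structure IsProjections (ℳ : ℤ → Submodule K M) (π : ℤ → M →ₗ[K] M) : Prop where
  mem : ∀ i x, π i x ∈ ℳ i
  same : ∀ i, ∀ x ∈ ℳ i, π i x = x
  ne : ∀ i j, ∀ x ∈ ℳ i, i ≠ j → π j x = 0
  top : ⨆ i, ℳ i = ⊤

lemma exists_isProjections {ℳ : ℤ → Submodule K M} (h : DirectSum.IsInternal ℳ) :
    ∃ π, IsProjections ℳ π := by
  let D : DirectSum.Decomposition ℳ := h.chooseDecomposition
  refine ⟨fun i ↦ (ℳ i).subtype ∘ₗ DirectSum.component K ℤ (fun i ↦ ℳ i) i ∘ₗ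
    (DirectSum.decomposeLinearEquiv ℳ).toLinearMap, fun i x ↦ ?_, fun i x hx ↦ ?_,
    fun i j x hx hij ↦ ?_, h.submodule_iSup_eq_top⟩
  · exact Subtype.property _
  · exact DirectSum.decompose_of_mem_same ℳ hx
  · exact DirectSum.decompose_of_mem_ne ℳ hx hij

lemma IsProjections.isInternal {ℳ : ℤ → Submodule K M} {π : ℤ → M →ₗ[K] M}
    (h : IsProjections ℳ π) : DirectSum.IsInternal ℳ := by
  rw [DirectSum.isInternal_submodule_iff_iSupIndep_and_iSup_eq_top]
  refine ⟨fun i ↦ ?_, h.top⟩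
  rw [Submodule.disjoint_def]
  intro x hx hx'
  rw [← h.same i x hx]
  have : (⨆ j, ⨆ (_ : j ≠ i), ℳ j) ≤ LinearMap.ker (π i) :=
    iSup₂_le fun j hj y hy ↦ h.ne j i y hy hj
  exact this hx'

end Projections

/-! ### Graded modules, linear forms and differences of Hilbert functions. -/

section Graded

open RingTheory.Sequence Pointwise

variable {σ : Type v} {K : Type u} [Field K] {M : Type w} [AddCommGroup M] [Module K M]
  [Module (MvPolynomial σ K) M] {ℳ : ℤ → Submodule K M}

/-- Projections commute with multiplication by homogeneous polynomials, up to a shift. -/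
lemma IsProjections.smul [IsScalarTower K (MvPolynomial σ K) M] {π : ℤ → M →ₗ[K] M}
    (hπ : IsProjections ℳ π) (hℳ : IsGrading σ ℳ) {d : ℕ} {p : MvPolynomial σ K}
    (hp : p ∈ MvPolynomial.homogeneousSubmodule σ K d) (i : ℤ) (x : M) :
    π (i + d) (p • x) = p • π i x := by
  have hx : x ∈ ⨆ i, ℳ i := hπ.top ▸ Submodule.mem_top
  induction hx using Submodule.iSup_induction' with
  | mem j x hx =>
    by_cases hij : j = i
    · subst hij
      rw [hπ.same j x hx, hπ.same _ _ (hℳ.smul_mem d j p x hp hx)]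
    · rw [hπ.ne j i x hx hij, smul_zero,
        hπ.ne (j + d) _ _ (hℳ.smul_mem d j p x hp hx) (by simpa using hij)]
  | zero => simp
  | add x y _ _ hx hy => simp only [smul_add, map_add, hx, hy]

/-- The pieces of a finitely generated graded module are finite-dimensional. -/
lemma IsGrading.finite_piece [Finite σ] [IsScalarTower K (MvPolynomial σ K) M]
    [Module.Finite (MvPolynomial σ K) M] (hℳ : IsGrading σ ℳ) (i : ℤ) :
    Module.Finite K (ℳ i) := by
  obtain ⟨π, hπ⟩ := exists_isProjections hℳ.isInternal
  -- The submodule generated by W ⊆ M_i meets degree i in W only. Vanishing below degree i is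
  -- carried along so that components of positive degree contribute nothing in degree i.
  have key : ∀ W : Submodule K M, W ≤ ℳ i → ∀ x ∈ Submodule.span (MvPolynomial σ K) (W : Set M),
      π i x ∈ W ∧ ∀ j < i, π j x = 0 := by
    intro W hW x hx
    induction hx using Submodule.span_induction with
    | mem x hx => exact ⟨by rwa [hπ.same i x (hW hx)], fun j hj ↦ hπ.ne i j x (hW hx) hj.ne'⟩
    | zero => simp
    | add x y _ _ hx hy =>
      exact ⟨by rw [map_add]; exact W.add_mem hx.1 hy.1,
        fun j hj ↦ by rw [map_add, hx.2 j hj, hy.2 j hj, add_zero]⟩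
    | smul p x _ hx =>
      have hsum : ∀ j, π j (p • x) = ∑ d ∈ Finset.range (p.totalDegree + 1),
          MvPolynomial.homogeneousComponent d p • π (j - d) x := by
        intro j
        conv_lhs => rw [← MvPolynomial.sum_homogeneousComponent p, Finset.sum_smul, map_sum]
        refine Finset.sum_congr rfl fun d _ ↦ ?_
        rw [← hπ.smul hℳ (MvPolynomial.homogeneousComponent_mem d p), sub_add_cancel]
      refine ⟨?_, fun j hj ↦ ?_⟩
      · rw [hsum]
        refine W.sum_mem fun d _ ↦ ?_
        rcases d.eq_zero_or_pos with rfl | hd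
        · rw [MvPolynomial.homogeneousComponent_zero, ← MvPolynomial.algebraMap_eq,
            algebraMap_smul, Nat.cast_zero, sub_zero]
          exact W.smul_mem _ hx.1
        · rw [hx.2 _ (by omega), smul_zero]
          exact W.zero_mem
      · rw [hsum]
        exact Finset.sum_eq_zero fun d _ ↦ by rw [hx.2 _ (by omega), smul_zero]
  -- Since W is recovered from S·W, ascending chains of subspaces of M_i embed into chains of
  -- submodules of the Noetherian module `M`.
  let F : Submodule K (ℳ i) → Submodule (MvPolynomial σ K) M :=
    fun W ↦ Submodule.span _ ((W.map (ℳ i).subtype : Submodule K M) : Set M)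
  have hF : StrictMono F := by
    refine Monotone.strictMono_of_injective
      (fun W W' h ↦ Submodule.span_mono (Submodule.map_mono h)) fun W W' h ↦ ?_
    have hle : ∀ W W' : Submodule K (ℳ i), F W = F W' → W ≤ W' := by
      intro W W' h x hx
      have hx' : (x : M) ∈ F W' := h ▸ Submodule.subset_span ⟨x, hx, rfl⟩
      have := (key _ (Submodule.map_subtype_le _ _) _ hx').1
      rw [hπ.same i x x.2] at this
      obtain ⟨y, hy, hyx⟩ := this
      rwa [← Subtype.ext hyx]
    exact le_antisymm (hle _ _ h) (hle _ _ h.symm)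
  have : WellFoundedGT (Submodule K (ℳ i)) := hF.wellFoundedGT
  have : IsNoetherian K (ℳ i) := isNoetherian_iff'.2 this
  infer_instance

variable [IsScalarTower K (MvPolynomial σ K) M]

/-- The quotient map `M → M ⧸ lM` as a linear map over the base field. -/
noncomputable def quotSMulTopMk (M : Type w) [AddCommGroup M] [Module K M]
    [Module (MvPolynomial σ K) M] [IsScalarTower K (MvPolynomial σ K) M] (l : MvPolynomial σ K) :
    M →ₗ[K] QuotSMulTop l M :=
  (l • (⊤ : Submodule (MvPolynomial σ K) M)).mkQ.restrictScalars K

lemma quotSMulTopMk_surjective (l : MvPolynomial σ K) :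
    Function.Surjective (quotSMulTopMk M l) := fun x ↦
  Submodule.mkQ_surjective (l • (⊤ : Submodule (MvPolynomial σ K) M)) x

lemma quotSMulTopMk_smul (l p : MvPolynomial σ K) (x : M) :
    quotSMulTopMk M l (p • x) = p • quotSMulTopMk M l x :=
  (l • (⊤ : Submodule (MvPolynomial σ K) M)).mkQ.map_smul p x

lemma quotSMulTopMk_eq_zero_iff {l : MvPolynomial σ K} {x : M} :
    quotSMulTopMk M l x = 0 ↔ ∃ y, l • y = x := by
  have h : quotSMulTopMk M l x = 0 ↔ x ∈ l • (⊤ : Submodule (MvPolynomial σ K) M) :=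
    Submodule.Quotient.mk_eq_zero _
  rw [h, Submodule.mem_smul_pointwise_iff_exists]
  simp

/-- The grading induced on the quotient by a linear form. -/
noncomputable def quotSMulTopGrading (l : MvPolynomial σ K) (ℳ : ℤ → Submodule K M) (i : ℤ) :
    Submodule K (QuotSMulTop l M) :=
  (ℳ i).map (quotSMulTopMk M l)

lemma IsProjections.smul_of_degree_one {π : ℤ → M →ₗ[K] M}
    (hπ : IsProjections ℳ π) (hℳ : IsGrading σ ℳ) {l : MvPolynomial σ K}
    (hl : l ∈ MvPolynomial.homogeneousSubmodule σ K 1) (i : ℤ) (x : M) :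
    π i (l • x) = l • π (i - 1) x := by
  have h := hπ.smul hℳ hl (i - 1) x
  rwa [Nat.cast_one, sub_add_cancel] at h

lemma IsGrading.quotSMulTop (hℳ : IsGrading σ ℳ) {l : MvPolynomial σ K}
    (hl : l ∈ MvPolynomial.homogeneousSubmodule σ K 1) :
    IsGrading σ (quotSMulTopGrading l ℳ) := by
  obtain ⟨π, hπ⟩ := exists_isProjections hℳ.isInternal
  set q := quotSMulTopMk M l with hqdef
  have hq : Function.Surjective q := quotSMulTopMk_surjective l
  -- As `l` is homogeneous, each projection maps lM into itself and so descends to the quotient.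
  have hker : ∀ i, LinearMap.ker q ≤ LinearMap.ker (q ∘ₗ π i) := by
    intro i x hx
    obtain ⟨y, rfl⟩ := quotSMulTopMk_eq_zero_iff.1 (LinearMap.mem_ker.1 hx)
    rw [LinearMap.mem_ker, LinearMap.comp_apply, hπ.smul_of_degree_one hℳ hl]
    exact quotSMulTopMk_eq_zero_iff.2 ⟨_, rfl⟩
  let ρ : ℤ → QuotSMulTop l M →ₗ[K] QuotSMulTop l M := fun i ↦
    (LinearMap.ker q).liftQ (q ∘ₗ π i) (hker i) ∘ₗ (q.quotKerEquivOfSurjective hq).symm.toLinearMap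
  have hρ : ∀ i x, ρ i (q x) = q (π i x) := fun i x ↦ by
    have : (q.quotKerEquivOfSurjective hq).symm (q x) = Submodule.Quotient.mk x := by
      rw [LinearEquiv.symm_apply_eq]
      rfl
    simp only [ρ, LinearMap.comp_apply, LinearEquiv.coe_coe, this]
    rfl
  refine ⟨IsProjections.isInternal (π := ρ) ⟨?_, ?_, ?_, ?_⟩, ?_⟩
  · intro i x
    obtain ⟨x, rfl⟩ := hq x
    exact ⟨π i x, hπ.mem i x, (hρ i x).symm⟩
  · rintro i _ ⟨x, hx, rfl⟩
    exact (hρ i x).trans (congrArg q (hπ.same i x hx))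
  · rintro i j _ ⟨x, hx, rfl⟩ hij
    exact (hρ j x).trans ((congrArg q (hπ.ne i j x hx hij)).trans (map_zero q))
  · change ⨆ i, (ℳ i).map q = ⊤
    rw [← Submodule.map_iSup, hπ.top, Submodule.map_top, LinearMap.range_eq_top.2 hq]
  · rintro d i p _ hp ⟨x, hx, rfl⟩
    exact ⟨p • x, hℳ.smul_mem d i p x hp hx, quotSMulTopMk_smul l p x⟩

/-- Dimension count in the exact sequence 0 → M_{i-1} → M_i → (M/lM)_i → 0. Exactness in the middle
holds because a preimage under `l` can be replaced by its component of degree i - 1. -/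
lemma hilbertFunction_quotSMulTop [Finite σ] [Module.Finite (MvPolynomial σ K) M]
    (hℳ : IsGrading σ ℳ) {l : MvPolynomial σ K}
    (hl : l ∈ MvPolynomial.homogeneousSubmodule σ K 1) (hreg : IsSMulRegular M l) (i : ℤ) :
    (hilbertFunction (quotSMulTopGrading l ℳ) i : ℤ) =
      hilbertFunction ℳ i - hilbertFunction ℳ (i - 1) := by
  obtain ⟨π, hπ⟩ := exists_isProjections hℳ.isInternal
  have := hℳ.finite_piece i
  let m : M →ₗ[K] M := (LinearMap.lsmul (MvPolynomial σ K) M l).restrictScalars K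
  have hm : ∀ x ∈ ℳ (i - 1), m x ∈ ℳ i := fun x hx ↦ by
    simpa using! hℳ.smul_mem 1 (i - 1) l x hl hx
  let μ : ℳ (i - 1) →ₗ[K] ℳ i := m.restrict hm
  have hμ : Function.Injective μ := fun x y hxy ↦ Subtype.ext (hreg (congrArg Subtype.val hxy))
  let φ : ℳ i →ₗ[K] QuotSMulTop l M := quotSMulTopMk M l ∘ₗ (ℳ i).subtype
  have hφ : ∀ x : ℳ i, φ x = 0 ↔ ∃ y : M, l • y = x := fun x ↦
    quotSMulTopMk_eq_zero_iff (l := l) (x := (x : M))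
  have hrange : LinearMap.range φ = quotSMulTopGrading l ℳ i := by
    rw [LinearMap.range_comp, Submodule.range_subtype]
    rfl
  have hker : LinearMap.ker φ = LinearMap.range μ := by
    ext x
    constructor
    · intro hx
      obtain ⟨y, hy⟩ := (hφ x).1 (LinearMap.mem_ker.1 hx)
      refine ⟨⟨π (i - 1) y, hπ.mem _ _⟩, Subtype.ext ?_⟩
      change l • π (i - 1) y = x
      rw [← hπ.smul_of_degree_one hℳ hl, hy]
      exact hπ.same i x x.2
    · rintro ⟨y, rfl⟩
      exact LinearMap.mem_ker.2 ((hφ _).2 ⟨y, rfl⟩)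
  have h := φ.finrank_range_add_finrank_ker
  rw [hrange, hker, LinearMap.finrank_range_of_inj hμ] at h
  simp only [hilbertFunction]
  omega

/-- The backward difference operator. -/
def backwardDiff (f : ℤ → ℤ) (i : ℤ) : ℤ := f i - f (i - 1)

lemma span_homogeneousSubmodule_one (σ : Type v) (K : Type u) [Field K] :
    Ideal.span (MvPolynomial.homogeneousSubmodule σ K 1 : Set (MvPolynomial σ K)) =
      MvPolynomial.idealOfVars σ K := by
  rw [MvPolynomial.homogeneousSubmodule_one_eq_span_X]
  apply le_antisymm
  · rw [Ideal.span_le]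
    exact Submodule.span_le_restrictScalars K (MvPolynomial σ K) _
  · exact Ideal.span_mono Submodule.subset_span

lemma isMaximal_idealOfVars (σ : Type v) (K : Type u) [Field K] :
    (MvPolynomial.idealOfVars σ K).IsMaximal := by
  have : MvPolynomial.idealOfVars σ K =
      RingHom.ker (MvPolynomial.constantCoeff : MvPolynomial σ K →+* K) := by
    ext p
    rw [← pow_one (MvPolynomial.idealOfVars σ K), MvPolynomial.mem_pow_idealOfVars_iff',
      RingHom.mem_ker, MvPolynomial.constantCoeff_eq]
    simp [Finsupp.degree_eq_zero_iff]
  rw [this]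
  exact RingHom.ker_isMaximal_of_surjective _ fun a ↦ ⟨MvPolynomial.C a, by simp⟩

/-- Over an infinite field, a graded module with a regular sequence of length `d` has a Hilbert
function whose `d`-th difference is nonnegative. -/
theorem HasRegularSeq.iterate_backwardDiff_nonneg_of_infinite [Finite σ] [Infinite K] {d : ℕ} :
    ∀ {M : Type w} [AddCommGroup M] [Module K M] [Module (MvPolynomial σ K) M]
      [IsScalarTower K (MvPolynomial σ K) M] [Module.Finite (MvPolynomial σ K) M]
      {ℳ : ℤ → Submodule K M}, IsGrading σ ℳ →
      HasRegularSeq (MvPolynomial.idealOfVars σ K) M d →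
      ∀ i, 0 ≤ backwardDiff^[d] (fun i ↦ (hilbertFunction ℳ i : ℤ)) i := by
  have hmax := isMaximal_idealOfVars σ K
  have hV := span_homogeneousSubmodule_one σ K
  induction d with
  | zero => exact fun _ _ i ↦ Int.natCast_nonneg _
  | succ d ih =>
    intro M _ _ _ _ _ ℳ hℳ h i
    obtain ⟨r, hr, hrM, -⟩ := hasRegularSeq_succ_iff.1 h
    -- The possibly inhomogeneous `r` only serves to show that `𝔪` kills no nonzero element. The
    -- quotient is taken by a linear form instead, so that it stays graded.
    obtain ⟨l, hl, hreg⟩ := exists_isSMulRegular_mem_submodule hV M fun x hx ↦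
      hrM.right_eq_zero_of_smul (hx r hr)
    have h' := h.quotSMulTop hV M l (hV ▸ Ideal.subset_span hl) hreg
    have := ih (hℳ.quotSMulTop hl) h' i
    rw [Function.iterate_succ_apply]
    convert this using 3
    exact (hilbertFunction_quotSMulTop hℳ hl hreg _).symm

end Graded

/-! ### Extension of the ground field to an infinite one. -/

section BaseChange

open RingTheory.Sequence Pointwise TensorProduct

attribute [local instance] MvPolynomial.algebraMvPolynomial

variable {σ : Type v} {K : Type u} [Field K] {M : Type w} [AddCommGroup M] [Module K M]
  [Module (MvPolynomial σ K) M] [IsScalarTower K (MvPolynomial σ K) M] {ℳ : ℤ → Submodule K M}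
  (L : Type u) [Field L] [Algebra K L]

instance flat_mvPolynomial : Module.Flat (MvPolynomial σ K) (MvPolynomial σ L) :=
  Module.Flat.isBaseChange K (MvPolynomial σ K) L (MvPolynomial σ L)
    (Algebra.IsPushout.out (R := K) (S := MvPolynomial σ K) (R' := L) (S' := MvPolynomial σ L))

/-- Extension of scalars of the coefficients of a module over a polynomial ring. -/
abbrev ExtendScalars (σ : Type v) (K : Type u) [Field K] (M : Type w) [AddCommGroup M]
    [Module (MvPolynomial σ K) M] (L : Type u) [Field L] [Algebra K L] :=
  MvPolynomial σ L ⊗[MvPolynomial σ K] M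

/-- Extending the coefficients is the same as extending the scalars of the vector space. -/
noncomputable def extendScalarsEquiv : ExtendScalars σ K M L ≃ₗ[L] L ⊗[K] M :=
  Algebra.IsPushout.cancelBaseChange K L (MvPolynomial σ K) (MvPolynomial σ L) M

lemma extendScalarsEquiv_symm_tmul (a : L) (x : M) :
    (extendScalarsEquiv (σ := σ) (K := K) L).symm (a ⊗ₜ x) =
      MvPolynomial.C (σ := σ) a ⊗ₜ[MvPolynomial σ K] x := by
  rw [extendScalarsEquiv, Algebra.IsPushout.cancelBaseChange_symm_tmul]
  rfl

lemma extendScalarsEquiv_tmul (x : M) :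
    extendScalarsEquiv (σ := σ) (K := K) L (1 ⊗ₜ x) = 1 ⊗ₜ[K] x := by
  rw [← LinearEquiv.eq_symm_apply, extendScalarsEquiv_symm_tmul, map_one]

/-- The grading of the extension of scalars. -/
noncomputable def extendScalarsGrading (ℳ : ℤ → Submodule K M) (i : ℤ) :
    Submodule L (ExtendScalars σ K M L) :=
  ((ℳ i).baseChange L).map (extendScalarsEquiv (σ := σ) (K := K) L).symm.toLinearMap

lemma extendScalarsGrading_eq_span (i : ℤ) :
    extendScalarsGrading (σ := σ) L ℳ i =
      Submodule.span L ((fun x : M ↦ (1 : MvPolynomial σ L) ⊗ₜ[MvPolynomial σ K] x) '' ℳ i) := by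
  rw [extendScalarsGrading, Submodule.baseChange_eq_span, Submodule.map_span, Submodule.map_coe,
    ← Set.image_comp]
  congr 1
  refine Set.image_congr fun x _ ↦ ?_
  exact (extendScalarsEquiv_symm_tmul L 1 x).trans (by rw [map_one])

lemma hilbertFunction_extendScalarsGrading (i : ℤ) :
    hilbertFunction (extendScalarsGrading (σ := σ) L ℳ) i = hilbertFunction ℳ i := by
  rw [hilbertFunction, extendScalarsGrading, LinearEquiv.finrank_map_eq,
    ← (Submodule.toBaseChange.toLinearEquiv L (ℳ i)).finrank_eq, Module.finrank_baseChange,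
    hilbertFunction]

lemma IsGrading.extendScalars (hℳ : IsGrading σ ℳ) :
    IsGrading σ (extendScalarsGrading (σ := σ) L ℳ) := by
  obtain ⟨π, hπ⟩ := exists_isProjections hℳ.isInternal
  let e := extendScalarsEquiv (σ := σ) (K := K) (M := M) L
  let ρ : ℤ → ExtendScalars σ K M L →ₗ[L] ExtendScalars σ K M L :=
    fun i ↦ e.symm.toLinearMap ∘ₗ (π i).baseChange L ∘ₗ e.toLinearMap
  have hρ : ∀ i x, ρ i (1 ⊗ₜ x) = 1 ⊗ₜ π i x := fun i x ↦ by
    simp only [ρ, e, LinearMap.comp_apply, LinearEquiv.coe_coe, extendScalarsEquiv_tmul,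
      LinearMap.baseChange_tmul, extendScalarsEquiv_symm_tmul, map_one]
  have hspan : Submodule.span L (Set.range fun x : M ↦
      (1 : MvPolynomial σ L) ⊗ₜ[MvPolynomial σ K] x) = ⊤ := by
    have h := extendScalarsGrading_eq_span (σ := σ) L (ℳ := fun _ : ℤ ↦ (⊤ : Submodule K M)) 0
    rw [extendScalarsGrading, Submodule.baseChange_top, Submodule.map_top, LinearEquiv.range,
      Submodule.top_coe, Set.image_univ] at h
    exact h.symm
  refine ⟨IsProjections.isInternal (π := ρ) ⟨?_, ?_, ?_, ?_⟩, ?_⟩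
  · intro i x
    have hx : x ∈ Submodule.span L (Set.range fun x : M ↦
      (1 : MvPolynomial σ L) ⊗ₜ[MvPolynomial σ K] x) := hspan ▸ Submodule.mem_top
    induction hx using Submodule.span_induction with
    | mem x hx =>
      obtain ⟨x, rfl⟩ := hx
      rw [hρ, extendScalarsGrading_eq_span]
      exact Submodule.subset_span ⟨_, hπ.mem i x, rfl⟩
    | zero => rw [map_zero]; exact Submodule.zero_mem _
    | add x y _ _ hx hy => rw [map_add]; exact Submodule.add_mem _ hx hy
    | smul a x _ hx => rw [map_smul]; exact Submodule.smul_mem _ a hx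
  · intro i x hx
    rw [extendScalarsGrading_eq_span] at hx
    have : Submodule.span L ((fun x : M ↦ (1 : MvPolynomial σ L) ⊗ₜ[MvPolynomial σ K] x) '' ℳ i) ≤
        LinearMap.eqLocus (ρ i) LinearMap.id := Submodule.span_le.2 (by
      rintro _ ⟨x, hx, rfl⟩
      exact (hρ i x).trans (congrArg _ (hπ.same i x hx)))
    exact this hx
  · intro i j x hx hij
    rw [extendScalarsGrading_eq_span] at hx
    have : Submodule.span L ((fun x : M ↦ (1 : MvPolynomial σ L) ⊗ₜ[MvPolynomial σ K] x) '' ℳ i) ≤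
        LinearMap.ker (ρ j) := Submodule.span_le.2 (by
      rintro _ ⟨x, hx, rfl⟩
      exact (hρ j x).trans ((congrArg _ (hπ.ne i j x hx hij)).trans (tmul_zero _ _)))
    exact this hx
  · rw [eq_top_iff, ← hspan, Submodule.span_le]
    rintro _ ⟨x, rfl⟩
    have hx : x ∈ ⨆ i, ℳ i := hπ.top ▸ Submodule.mem_top
    induction hx using Submodule.iSup_induction' with
    | mem i x hx =>
      refine Submodule.mem_iSup_of_mem i ?_
      rw [extendScalarsGrading_eq_span]
      exact Submodule.subset_span ⟨_, hx, rfl⟩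
    | zero => simp
    | add x y _ _ hx hy => simp only [tmul_add]; exact Submodule.add_mem _ hx hy
  · intro d i p x hp hx
    -- Monomials suffice: the coefficient is a scalar of `L`, and the monomial with coefficient 1
    -- already acts on the original module.
    rw [p.as_sum, Finset.sum_smul]
    refine Submodule.sum_mem _ fun m hm ↦ ?_
    have hdeg : m.degree = d := by
      rw [MvPolynomial.mem_homogeneousSubmodule] at hp
      by_contra hne
      exact MvPolynomial.mem_support_iff.1 hm (hp.coeff_eq_zero hne)
    rw [extendScalarsGrading_eq_span] at hx ⊢
    induction hx using Submodule.span_induction with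
    | mem x hx =>
      obtain ⟨y, hy, rfl⟩ := hx
      have h1 : MvPolynomial.monomial m (p.coeff m) • (1 ⊗ₜ[MvPolynomial σ K] y) =
          p.coeff m • ((1 : MvPolynomial σ L) ⊗ₜ[MvPolynomial σ K]
            (MvPolynomial.monomial m (1 : K) • y)) := by
        rw [← smul_tmul, smul_tmul', smul_tmul',
          Algebra.smul_def (MvPolynomial.monomial m (1 : K)), MvPolynomial.algebraMap_def,
          smul_eq_mul, mul_one, mul_one, MvPolynomial.map_monomial, map_one,
          MvPolynomial.smul_monomial, smul_eq_mul, mul_one]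
      simp only [h1]
      exact Submodule.smul_mem _ _ (Submodule.subset_span ⟨_, hℳ.smul_mem d i _ y
        (MvPolynomial.isHomogeneous_monomial _ hdeg) hy, rfl⟩)
    | zero => rw [smul_zero]; exact Submodule.zero_mem _
    | add x y _ _ hx hy => rw [smul_add]; exact Submodule.add_mem _ hx hy
    | smul a x _ hx => rw [smul_comm]; exact Submodule.smul_mem _ a hx

/-- Flatness preserves weak regularity. No nonvanishing of the last quotient has to be transported,
which is an advantage of working with weakly regular sequences. -/
lemma HasRegularSeq.extendScalars {N : Type w} [AddCommGroup N] [Module (MvPolynomial σ K) N]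
    {d : ℕ} (h : HasRegularSeq (MvPolynomial.idealOfVars σ K) N d) :
    HasRegularSeq (MvPolynomial.idealOfVars σ L) (ExtendScalars σ K N L) d := by
  obtain ⟨rs, hl, hm, hr⟩ := h
  have hbase : IsBaseChange (MvPolynomial σ L)
      (TensorProduct.mk (MvPolynomial σ K) (MvPolynomial σ L) N 1) :=
    TensorProduct.isBaseChange _ _ _
  refine ⟨rs.map (algebraMap _ (MvPolynomial σ L)), by simpa using hl, ?_,
    hr.of_flat_of_isBaseChange hbase⟩
  intro t ht
  obtain ⟨r, hrs, rfl⟩ := List.mem_map.1 ht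
  have hle : (MvPolynomial.idealOfVars σ K).map (algebraMap _ (MvPolynomial σ L)) ≤
      MvPolynomial.idealOfVars σ L := by
    rw [MvPolynomial.idealOfVars, Ideal.map_span, Ideal.span_le]
    rintro _ ⟨_, ⟨s, rfl⟩, rfl⟩
    rw [MvPolynomial.algebraMap_def, MvPolynomial.map_X]
    exact Ideal.subset_span ⟨s, rfl⟩
  exact hle (Ideal.mem_map_of_mem _ (hm r hrs))

/-- A graded module with a regular sequence of length `d` has a Hilbert function whose `d`-th
difference is nonnegative. -/
theorem HasRegularSeq.iterate_backwardDiff_nonneg [Finite σ]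
    [Module.Finite (MvPolynomial σ K) M] (hℳ : IsGrading σ ℳ) {d : ℕ}
    (h : HasRegularSeq (MvPolynomial.idealOfVars σ K) M d) (i : ℤ) :
    0 ≤ backwardDiff^[d] (fun i ↦ (hilbertFunction ℳ i : ℤ)) i := by
  have hG := hℳ.extendScalars (AlgebraicClosure K)
  have := HasRegularSeq.iterate_backwardDiff_nonneg_of_infinite hG
    (h.extendScalars (AlgebraicClosure K)) i
  simpa only [hilbertFunction_extendScalarsGrading] using this

end BaseChange

/-! ### Power series calculus with 1/(1-t)^p, and decomposition into free pieces. -/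

section HilbertSeries

/-- The Hilbert function of a polynomial ring in `p` variables. -/
def polyHilbert (p : ℕ) (i : ℤ) : ℤ := if i < 0 then 0 else (p.multichoose i.toNat : ℤ)

lemma polyHilbert_of_neg (p : ℕ) {i : ℤ} (hi : i < 0) : polyHilbert p i = 0 := if_pos hi

lemma polyHilbert_natCast (p k : ℕ) : polyHilbert p k = p.multichoose k := by
  simp [polyHilbert]

lemma polyHilbert_zero (i : ℤ) : polyHilbert 0 i = if i = 0 then 1 else 0 := by
  rcases lt_trichotomy i 0 with hi | rfl | hi
  · rw [polyHilbert_of_neg _ hi, if_neg hi.ne]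
  · simp [polyHilbert]
  · obtain ⟨k, rfl⟩ : ∃ k : ℕ, i = (k + 1 : ℕ) := ⟨i.toNat - 1, by omega⟩
    rw [polyHilbert_natCast, Nat.multichoose_zero_succ, if_neg (by omega), Nat.cast_zero]

lemma backwardDiff_polyHilbert (p : ℕ) : backwardDiff (polyHilbert (p + 1)) = polyHilbert p := by
  ext i
  rw [backwardDiff]
  rcases lt_trichotomy i 0 with hi | rfl | hi
  · rw [polyHilbert_of_neg _ hi, polyHilbert_of_neg _ hi, polyHilbert_of_neg _ (by omega), sub_zero]
  · simp [polyHilbert]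
  · obtain ⟨k, rfl⟩ : ∃ k : ℕ, i = (k + 1 : ℕ) := ⟨i.toNat - 1, by omega⟩
    rw [show ((k + 1 : ℕ) : ℤ) - 1 = (k : ℕ) by omega]
    simp only [polyHilbert_natCast, Nat.multichoose_succ_succ]
    push_cast
    ring

lemma iterate_backwardDiff_polyHilbert (p d : ℕ) :
    backwardDiff^[d] (polyHilbert (p + d)) = polyHilbert p := by
  induction d with
  | zero => rfl
  | succ d ih => rw [Function.iterate_succ_apply, ← add_assoc, backwardDiff_polyHilbert, ih]

lemma iterate_backwardDiff_eq_zero_of_neg {f : ℤ → ℤ} (hf : ∀ i < 0, f i = 0) (d : ℕ) :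
    ∀ i < 0, backwardDiff^[d] f i = 0 := by
  induction d with
  | zero => exact hf
  | succ d ih =>
    intro i hi
    rw [Function.iterate_succ_apply', backwardDiff, ih i hi, ih _ (by omega), sub_zero]

/-- `polyHilbert 0` is the series 1, so these are the coefficients of (1-t)^d. -/
lemma iterate_backwardDiff_polyHilbert_zero (d k : ℕ) :
    backwardDiff^[d] (polyHilbert 0) k = (-1) ^ k * d.choose k := by
  induction d generalizing k with
  | zero =>
    rw [Function.iterate_zero_apply, polyHilbert_natCast]
    cases k <;> simp
  | succ d ih =>
    rw [Function.iterate_succ_apply', backwardDiff]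
    cases k with
    | zero =>
      rw [ih, iterate_backwardDiff_eq_zero_of_neg (fun _ ↦ polyHilbert_of_neg 0) d _ (by simp)]
      simp
    | succ k =>
      rw [show ((k + 1 : ℕ) : ℤ) - 1 = (k : ℕ) by omega, ih, ih, Nat.choose_succ_succ]
      push_cast
      ring

lemma iterate_backwardDiff_two_mul_sub (d : ℕ) (f g : ℤ → ℤ) :
    backwardDiff^[d] (fun i ↦ 2 * f i - g i) =
      fun i ↦ 2 * backwardDiff^[d] f i - backwardDiff^[d] g i := by
  induction d with
  | zero => rfl
  | succ d ih =>
    simp only [Function.iterate_succ_apply', ih]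
    ext i
    simp only [backwardDiff]
    ring

/-- The Hilbert functions of the finite direct sums of shifted polynomial rings in at least `a` and
at most `b` variables. -/
def freeHilbert (a b : ℕ) : AddSubmonoid (ℤ → ℤ) :=
  AddSubmonoid.closure {f | ∃ j k : ℕ, a ≤ j ∧ j ≤ b ∧ f = fun i ↦ polyHilbert j (i - k)}

lemma freeHilbert_mono {a a' b b' : ℕ} (ha : a' ≤ a) (hb : b ≤ b') :
    freeHilbert a b ≤ freeHilbert a' b' :=
  AddSubmonoid.closure_mono fun _ ⟨j, k, h1, h2, h⟩ ↦ ⟨j, k, ha.trans h1, h2.trans hb, h⟩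

lemma apply_eq_zero_of_mem_freeHilbert {a b : ℕ} {f : ℤ → ℤ} (hf : f ∈ freeHilbert a b) {i : ℤ}
    (hi : i < 0) : f i = 0 := by
  induction hf using AddSubmonoid.closure_induction with
  | mem f hf =>
    obtain ⟨j, k, -, -, rfl⟩ := hf
    exact polyHilbert_of_neg _ (by omega)
  | zero => rfl
  | add f g _ _ hf hg => rw [Pi.add_apply, hf, hg, add_zero]

lemma backwardDiff_add (f g : ℤ → ℤ) :
    backwardDiff (f + g) = backwardDiff f + backwardDiff g := by
  ext i
  simp only [backwardDiff, Pi.add_apply]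
  ring

lemma eq_of_backwardDiff_eq {f g : ℤ → ℤ} (hf : ∀ i < 0, f i = 0) (hg : ∀ i < 0, g i = 0)
    (h : backwardDiff f = backwardDiff g) : f = g := by
  -- The shift by one starts the induction in degree -1, where both functions vanish.
  have key : ∀ k : ℕ, f (k - 1) = g (k - 1) := by
    intro k
    induction k with
    | zero => rw [hf _ (by simp), hg _ (by simp)]
    | succ k ih =>
      have := congrFun h k
      simp only [backwardDiff, ih] at this
      push_cast
      rw [add_sub_cancel_right]
      linarith
  ext i
  by_cases hi : i < 0
  · rw [hf i hi, hg i hi]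
  · have := key (i.toNat + 1)
    rwa [show ((i.toNat + 1 : ℕ) : ℤ) - 1 = i by omega] at this

/-- Adjoining one more free variable to every summand sums up the Hilbert function. -/
lemma mem_freeHilbert_succ {a b : ℕ} {f : ℤ → ℤ} (hf : ∀ i < 0, f i = 0)
    (h : backwardDiff f ∈ freeHilbert a b) : f ∈ freeHilbert (a + 1) (b + 1) := by
  have key : ∀ F ∈ freeHilbert a b, ∃ G ∈ freeHilbert (a + 1) (b + 1), backwardDiff G = F := by
    intro F hF
    induction hF using AddSubmonoid.closure_induction with
    | mem F hF =>
      obtain ⟨j, k, hj, hj', rfl⟩ := hF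
      refine ⟨fun i ↦ polyHilbert (j + 1) (i - k), AddSubmonoid.subset_closure
        ⟨j + 1, k, by omega, by omega, rfl⟩, ?_⟩
      ext i
      rw [← backwardDiff_polyHilbert j]
      simp only [backwardDiff]
      rw [sub_right_comm]
    | zero => exact ⟨0, AddSubmonoid.zero_mem _, by ext; simp [backwardDiff]⟩
    | add F F' _ _ hF hF' =>
      obtain ⟨G, hG, rfl⟩ := hF
      obtain ⟨G', hG', rfl⟩ := hF'
      exact ⟨G + G', AddSubmonoid.add_mem _ hG hG', backwardDiff_add G G'⟩
  obtain ⟨G, hG, hGf⟩ := key _ h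
  rwa [eq_of_backwardDiff_eq hf (fun i ↦ apply_eq_zero_of_mem_freeHilbert hG) hGf.symm]

lemma mem_freeHilbert_of_iterate_backwardDiff {p d : ℕ} {f : ℤ → ℤ} (hf : ∀ i < 0, f i = 0)
    (h : backwardDiff^[d] f ∈ freeHilbert 0 p) : f ∈ freeHilbert d (p + d) := by
  induction d generalizing f with
  | zero => exact h
  | succ d ih =>
    refine mem_freeHilbert_succ hf (ih (fun i hi ↦ ?_) h)
    rw [backwardDiff, hf i hi, hf _ (by omega), sub_zero]

lemma shift_mem_freeHilbert (p k : ℕ) :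
    (fun i : ℤ ↦ polyHilbert 0 (i - k)) ∈ freeHilbert 0 p :=
  AddSubmonoid.subset_closure ⟨0, k, le_rfl, Nat.zero_le _, rfl⟩

/-- The Hilbert function of the `D`-th power of the ideal of the variables. -/
lemma truncation_mem_freeHilbert (p D : ℕ) :
    (fun i : ℤ ↦ if i < D then 0 else polyHilbert p i) ∈ freeHilbert 0 p := by
  induction p generalizing D with
  | zero =>
    rcases D.eq_zero_or_pos with rfl | hD
    · convert shift_mem_freeHilbert 0 0 using 2 with i
      rw [Nat.cast_zero, sub_zero]
      split_ifs with hi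
      · exact (polyHilbert_of_neg 0 hi).symm
      · rfl
    · convert AddSubmonoid.zero_mem _ using 2 with i
      split_ifs with hi
      · rfl
      · rw [polyHilbert_zero, if_neg (by omega), Pi.zero_apply]
  | succ p ih =>
    refine freeHilbert_mono (Nat.zero_le _) le_rfl (mem_freeHilbert_succ (a := 0) ?_ ?_)
    · intro i hi
      rw [if_pos (by omega)]
    -- The difference of the tail from D in p + 1 variables is a jump of height multichoose(p+1, D)
    -- in degree D, followed by the tail from D + 1 in p variables.
    · convert AddSubmonoid.add_mem _ (ih (D + 1))
        (AddSubmonoid.nsmul_mem _ (shift_mem_freeHilbert p D) ((p + 1).multichoose D)) using 1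
      ext i
      simp only [backwardDiff, Pi.add_apply, Pi.smul_apply, polyHilbert_zero]
      rcases lt_trichotomy i D with hi | rfl | hi
      · rw [if_pos hi, if_pos (by omega), if_pos (by omega), if_neg (by omega)]
        simp
      · rw [if_neg (lt_irrefl _), if_pos (by omega), if_pos (by omega), if_pos (by omega),
          polyHilbert_natCast]
        simp
      · rw [if_neg (by omega), if_neg (by omega), if_neg (by omega), if_neg (by omega),
          ← backwardDiff_polyHilbert p]
        simp [backwardDiff]

/-- The d-th difference has nonnegative coefficients. Up to degree d they are realized by copies of
shifted `K`. Beyond d the binomials vanish, and what remains is twice a truncated polynomial ring in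
p variables, so finitely many summands suffice. Summing d times adjoins d variables to every
summand. -/
lemma two_mul_polyHilbert_sub_mem_freeHilbert {p d : ℕ}
    (h : ∀ k, d.choose k ≤ 2 * p.multichoose k) :
    (fun i ↦ 2 * polyHilbert (p + d) i - polyHilbert 0 i) ∈ freeHilbert d (p + d) := by
  refine mem_freeHilbert_of_iterate_backwardDiff (fun i hi ↦ ?_) ?_
  · rw [polyHilbert_of_neg _ hi, polyHilbert_of_neg _ hi, mul_zero, sub_zero]
  rw [iterate_backwardDiff_two_mul_sub, iterate_backwardDiff_polyHilbert]
  set c : ℤ → ℤ := fun i ↦ 2 * polyHilbert p i - backwardDiff^[d] (polyHilbert 0) i with hc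
  have hcnat : ∀ k : ℕ, c k = 2 * p.multichoose k - (-1) ^ k * d.choose k := fun k ↦ by
    rw [hc]
    simp only
    rw [polyHilbert_natCast, iterate_backwardDiff_polyHilbert_zero]
  have hc0 : ∀ k : ℕ, 0 ≤ c k := by
    intro k
    have hk : (d.choose k : ℤ) ≤ 2 * p.multichoose k := by exact_mod_cast h k
    rw [hcnat]
    rcases neg_one_pow_eq_or ℤ k with h1 | h1 <;> rw [h1] <;> linarith
  have hneg : ∀ i < 0, c i = 0 := by
    intro i hi
    simp only [hc]
    rw [polyHilbert_of_neg p hi,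
      iterate_backwardDiff_eq_zero_of_neg (fun _ ↦ polyHilbert_of_neg 0) d i hi, mul_zero, sub_zero]
  have hmem : (∑ k ∈ Finset.range (d + 1), (c k).toNat • fun i : ℤ ↦ polyHilbert 0 (i - k)) +
      2 • (fun i : ℤ ↦ if i < (d + 1 : ℕ) then 0 else polyHilbert p i) ∈ freeHilbert 0 p :=
    AddSubmonoid.add_mem _ (AddSubmonoid.sum_mem _ fun k _ ↦ AddSubmonoid.nsmul_mem _
      (shift_mem_freeHilbert p k) _)
      (AddSubmonoid.nsmul_mem _ (truncation_mem_freeHilbert p (d + 1)) 2)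
  convert hmem using 1
  ext i
  simp only [Pi.add_apply, Finset.sum_apply, Pi.smul_apply, polyHilbert_zero]
  by_cases hi : i < 0
  · rw [hneg i hi, if_pos (by omega), Finset.sum_eq_zero]
    · simp
    · intro k _
      rw [if_neg (by omega), smul_zero]
  obtain ⟨k, rfl⟩ := Int.eq_ofNat_of_zero_le (not_lt.1 hi)
  by_cases hk : k < d + 1
  · rw [if_pos (by exact_mod_cast hk), Finset.sum_eq_single_of_mem k (Finset.mem_range.2 hk)]
    · simp [hc0 k]
    · intro j _ hj
      rw [if_neg (by omega), smul_zero]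
  · rw [if_neg (by exact_mod_cast hk), Finset.sum_eq_zero, hcnat, polyHilbert_natCast,
      Nat.choose_eq_zero_of_lt (by omega)]
    · simp
    · intro j hj
      rw [if_neg (by have := Finset.mem_range.1 hj; omega), smul_zero]

end HilbertSeries

/-! ### Comparison of binomial coefficients with multichoose numbers. -/

section Estimates

/-- First term of log((1+x)/(1-x)) = 2(x + x³/3 + …) at x = u/m. -/
lemma mul_exp_le_add {m u : ℝ} (hu : 0 ≤ u) (hm : u < m) :
    Real.exp (2 * u / m) * (m - u) ≤ m + u := by
  have hm0 : 0 < m := hu.trans_lt hm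
  have hx0 : 0 ≤ u / m := by positivity
  have hx1 : u / m < 1 := (div_lt_one hm0).2 hm
  have h := Real.hasSum_log_sub_log_of_abs_lt_one (x := u / m) (by rwa [abs_of_nonneg hx0])
  have h1 := sum_le_hasSum {0} (fun i _ ↦ by positivity) h
  rw [← Real.log_div (by positivity) (by linarith)] at h1
  have h2 : Real.exp (2 * u / m) ≤ (1 + u / m) / (1 - u / m) := by
    rw [← Real.le_log_iff_exp_le (div_pos (by positivity) (by linarith))]
    refine le_trans (le_of_eq ?_) h1
    simp
    ring
  have h3 : (1 + u / m) / (1 - u / m) = (m + u) / (m - u) := by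
    have : m - u ≠ 0 := by linarith
    have h' : 1 - u / m ≠ 0 := by linarith
    field_simp
  rwa [h3, le_div_iff₀ (by linarith)] at h2

/-- For z = (m+u)/(m-u), log z ≤ sinh(log z) = (z - 1/z)/2 = 2mu/(m² - u²). Replacing u² by s² makes
the factor of u independent of u. -/
lemma add_le_exp_mul {m s u : ℝ} (hu : 0 ≤ u) (hus : u ≤ s) (hs : s < m) :
    m + u ≤ Real.exp (2 * m / (m ^ 2 - s ^ 2) * u) * (m - u) := by
  have hm : 0 < m - u := by linarith
  have hz : 1 ≤ (m + u) / (m - u) := by rw [one_le_div hm]; linarith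
  have h := Real.self_le_sinh_iff.2 (Real.log_nonneg hz)
  rw [Real.sinh_log (by positivity)] at h
  have h2 : ((m + u) / (m - u) - ((m + u) / (m - u))⁻¹) / 2 = 2 * m * u / (m ^ 2 - u ^ 2) := by
    have h1 : m + u ≠ 0 := by linarith
    have h3 : m ^ 2 - u ^ 2 ≠ 0 := by
      rw [sq_sub_sq]; exact mul_ne_zero h1 hm.ne'
    have := hm.ne'
    rw [inv_div]
    field_simp
    ring
  have h3 : 2 * m * u / (m ^ 2 - u ^ 2) ≤ 2 * m / (m ^ 2 - s ^ 2) * u := by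
    rw [div_mul_eq_mul_div]
    have hs2 : u ^ 2 ≤ s ^ 2 := pow_le_pow_left₀ hu hus 2
    have hm2 : s ^ 2 < m ^ 2 := pow_lt_pow_left₀ hs (hu.trans hus) two_ne_zero
    exact div_le_div_of_nonneg_left (mul_nonneg (by linarith) hu) (by linarith) (by linarith)
  rw [h2] at h
  have h4 := (Real.log_le_iff_le_exp (by positivity)).1 (h.trans h3)
  rwa [div_le_iff₀ hm] at h4

/-- Midpoint rule for the convex function max(s - x, 0): the sum is at most its integral from -1/2
to infinity. The induction removes the term i = 0 and replaces s by s - 1. -/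
lemma sum_max_sub_le (k : ℕ) : ∀ s : ℝ,
    ∑ i ∈ Finset.range k, max (s - i) 0 ≤ max (s + 1 / 2) 0 ^ 2 / 2 := by
  induction k with
  | zero => intro s; simp; positivity
  | succ k ih =>
    intro s
    rw [Finset.sum_range_succ']
    have h := ih (s - 1)
    have heq : ∀ i ∈ Finset.range k, max (s - ((i + 1 : ℕ) : ℝ)) 0 = max (s - 1 - i) 0 :=
      fun i _ ↦ by push_cast; congr 1; ring
    rw [Finset.sum_congr rfl heq, Nat.cast_zero, sub_zero]
    rcases le_total s 0 with hs | hs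
    · rw [max_eq_right (by linarith : s - 1 + 1 / 2 ≤ 0)] at h
      rw [max_eq_right hs]
      have : 0 ≤ max (s + 1 / 2) 0 ^ 2 / 2 := by positivity
      linarith
    · rw [max_eq_left hs, max_eq_left (by linarith : 0 ≤ s + 1 / 2)]
      rcases le_total s (1 / 2) with hs' | hs'
      · rw [max_eq_right (by linarith : s - 1 + 1 / 2 ≤ 0)] at h
        nlinarith [sq_nonneg (s - 1 / 2)]
      · rw [max_eq_left (by linarith : 0 ≤ s - 1 + 1 / 2)] at h
        nlinarith

/-- Factors with i ≥ s have ratio at most 1; the others are bounded by `add_le_exp_mul`. The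
hypothesis `hb` says that the resulting total exp(c(s + 1/2)²/2), with c = 2m/(m² - s²), is at most
2. -/
lemma prod_add_sub_le {m s : ℝ} (hm : 0 < m) (hs : s < m) {k : ℕ}
    (hk : ∀ i ∈ Finset.range k, 0 ≤ m + s - i)
    (hb : 0 < s → m * (s + 1 / 2) ^ 2 ≤ Real.log 2 * (m ^ 2 - s ^ 2)) :
    ∏ i ∈ Finset.range k, (m + s - i) ≤ 2 * ∏ i ∈ Finset.range k, (m - s + i) := by
  have hpos : ∀ i ∈ Finset.range k, 0 ≤ m - s + i := fun i _ ↦ by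
    have : (0 : ℝ) ≤ i := Nat.cast_nonneg i
    linarith
  rcases le_or_gt s 0 with hs0 | hs0
  · have h1 : ∏ i ∈ Finset.range k, (m + s - i) ≤ ∏ i ∈ Finset.range k, (m - s + i) :=
      Finset.prod_le_prod hk fun i _ ↦ by
        have : (0 : ℝ) ≤ i := Nat.cast_nonneg i
        linarith
    have h2 := Finset.prod_nonneg hpos
    linarith
  have hden : 0 < m ^ 2 - s ^ 2 := by nlinarith
  set c := 2 * m / (m ^ 2 - s ^ 2) with hc
  have hc0 : 0 ≤ c := by positivity
  have h1 : ∏ i ∈ Finset.range k, (m + s - i) ≤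
      ∏ i ∈ Finset.range k, (Real.exp (c * max (s - i) 0) * (m - s + i)) := by
    refine Finset.prod_le_prod hk fun i _ ↦ ?_
    have hi : (0 : ℝ) ≤ i := Nat.cast_nonneg i
    rcases le_total (s - i) 0 with h | h
    · rw [max_eq_right h, mul_zero, Real.exp_zero]
      linarith
    · rw [max_eq_left h]
      have := add_le_exp_mul h (by linarith : s - i ≤ s) hs
      rw [← hc] at this
      rwa [show m + s - i = m + (s - i) by ring, show m - s + i = m - (s - i) by ring]
  rw [Finset.prod_mul_distrib, ← Real.exp_sum, ← Finset.mul_sum] at h1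
  refine h1.trans (mul_le_mul_of_nonneg_right ?_ (Finset.prod_nonneg hpos))
  rw [← Real.le_log_iff_exp_le two_pos]
  refine (mul_le_mul_of_nonneg_left (sum_max_sub_le k s) hc0).trans ?_
  rw [max_eq_left (by linarith), hc, div_mul_div_comm, div_le_iff₀ (by positivity)]
  nlinarith [hb hs0]

/-- The factorwise bounds from `mul_exp_le_add` multiply to the exponential of Σ 2(s-i)/m =
k(2s+1-k)/m, which `hb` makes larger than log 2. -/
lemma two_mul_prod_lt_prod {m s : ℝ} (hm : 0 < m) (hs : s < m) {k : ℕ}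
    (hk : ∀ i ∈ Finset.range k, 0 ≤ s - i) (hb : m * Real.log 2 < k * (2 * s + 1 - k)) :
    2 * ∏ i ∈ Finset.range k, (m - s + i) < ∏ i ∈ Finset.range k, (m + s - i) := by
  have hpos : 0 < ∏ i ∈ Finset.range k, (m - s + i) := Finset.prod_pos fun i _ ↦ by
    have : (0 : ℝ) ≤ i := Nat.cast_nonneg i
    linarith
  have hsum : ∀ k : ℕ, ∑ i ∈ Finset.range k, (2 * (s - i) / m) = k * (2 * s + 1 - k) / m := by
    intro k
    induction k with
    | zero => simp
    | succ k ih =>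
      rw [Finset.sum_range_succ, ih]
      push_cast
      ring
  have h1 : ∏ i ∈ Finset.range k, (Real.exp (2 * (s - i) / m) * (m - s + i)) ≤
      ∏ i ∈ Finset.range k, (m + s - i) := by
    refine Finset.prod_le_prod (fun i _ ↦ ?_) fun i hi ↦ ?_
    · have : (0 : ℝ) ≤ i := Nat.cast_nonneg i
      exact mul_nonneg (Real.exp_pos _).le (by linarith)
    · have : (0 : ℝ) ≤ i := Nat.cast_nonneg i
      have := mul_exp_le_add (hk i hi) (by linarith : s - i < m)
      rwa [show m + s - i = m + (s - i) by ring, show m - s + i = m - (s - i) by ring]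
  rw [Finset.prod_mul_distrib, ← Real.exp_sum, hsum] at h1
  refine lt_of_lt_of_le (mul_lt_mul_of_pos_right ?_ hpos) h1
  rwa [← Real.log_lt_iff_lt_exp two_pos, lt_div_iff₀ hm, mul_comm]

lemma factorial_mul_choose_eq_prod {d k : ℕ} (hk : k ≤ d) :
    (k.factorial * d.choose k : ℝ) = ∏ i ∈ Finset.range k, ((d : ℝ) - i) := by
  have h := Nat.descFactorial_eq_factorial_mul_choose d k
  rw [Nat.descFactorial_eq_prod_range] at h
  rw [← Nat.cast_mul, ← h, Nat.cast_prod]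
  refine Finset.prod_congr rfl fun i hi ↦ ?_
  rw [Nat.cast_sub ((Finset.mem_range.1 hi).le.trans hk)]

lemma factorial_mul_multichoose_eq_prod (p k : ℕ) :
    (k.factorial * p.multichoose k : ℝ) = ∏ i ∈ Finset.range k, ((p : ℝ) + i) := by
  have h := Nat.ascFactorial_eq_factorial_mul_choose' p k
  rw [Nat.ascFactorial_eq_prod_range, ← Nat.multichoose_eq] at h
  rw [← Nat.cast_mul, ← h, Nat.cast_prod]
  exact Finset.prod_congr rfl fun i _ ↦ Nat.cast_add _ _

lemma floor_half_bounds {n : ℕ} (hn : 2 ≤ n) :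
    1 ≤ (⌊(n : ℝ) / 2⌋ : ℝ) ∧ (⌊(n : ℝ) / 2⌋ : ℝ) ≤ (n : ℝ) / 2 ∧
      (n : ℝ) / 2 < ⌊(n : ℝ) / 2⌋ + 1 := by
  have h2 : (2 : ℝ) ≤ n := by exact_mod_cast hn
  refine ⟨?_, Int.floor_le _, Int.lt_floor_add_one _⟩
  exact_mod_cast Int.le_floor.2 (by push_cast; linarith : ((1 : ℤ) : ℝ) ≤ (n : ℝ) / 2)

lemma choose_le_two_mul_multichoose {n d p : ℕ} (hn : 2 ≤ n) (hpd : p + d = n)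
    (h : (d : ℝ) ≤ (n : ℝ) / 2 + √((⌊(n : ℝ) / 2⌋ : ℝ) * Real.log 2) - 1) (k : ℕ) :
    d.choose k ≤ 2 * p.multichoose k := by
  rcases lt_or_ge d k with hk | hk
  · rw [Nat.choose_eq_zero_of_lt hk]; exact Nat.zero_le _
  obtain ⟨ha1, ham, -⟩ := floor_half_bounds hn
  set a : ℝ := (⌊(n : ℝ) / 2⌋ : ℝ)
  set R := √(a * Real.log 2)
  set m : ℝ := (n : ℝ) / 2
  have hlog0 : 0 < Real.log 2 := Real.log_pos one_lt_two
  have hlog1 : Real.log 2 < 0.7 := Real.log_two_lt_d9.trans (by norm_num)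
  have hR0 : 0 ≤ R := Real.sqrt_nonneg _
  have hR2 : R ^ 2 = a * Real.log 2 := Real.sq_sqrt (by positivity)
  have hR2m : R ^ 2 ≤ m * Real.log 2 := hR2 ▸ mul_le_mul_of_nonneg_right ham hlog0.le
  have hm1 : 1 ≤ m := ha1.trans ham
  have hRm : R ≤ m := by nlinarith
  have hp : (p : ℝ) = m - (d - m) := by
    have : (p : ℝ) + d = n := by exact_mod_cast hpd
    simp only [m]; linarith
  have key := prod_add_sub_le (m := m) (s := d - m) (by linarith) (by linarith) (k := k)
    (fun i hi ↦ by
      have : (i : ℝ) ≤ d := by exact_mod_cast (Finset.mem_range.1 hi).le.trans hk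
      linarith) (fun hs ↦ by
      -- Here s = d - m ≤ R - 1, so (s + 1/2)² ≤ R² - R + 1/4. With mR² ≤ m² log 2 it remains to see
      -- that s² log 2 ≤ m(R - 1/4). The left side is at most 0.49m, and s > 0 forces R ≥ 1.
      have h1 : (d - m + 1 / 2) ^ 2 ≤ (R - 1 / 2) ^ 2 := by
        apply pow_le_pow_left₀ <;> linarith
      have h2 : (d - m) ^ 2 ≤ R ^ 2 := by apply pow_le_pow_left₀ <;> linarith
      have h3 : m * (d - m + 1 / 2) ^ 2 ≤ m * (R ^ 2 - R + 1 / 4) :=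
        mul_le_mul_of_nonneg_left (by linarith) (by linarith)
      have h4 : m * R ^ 2 ≤ m * (m * Real.log 2) := mul_le_mul_of_nonneg_left hR2m (by linarith)
      have h5 : Real.log 2 * (d - m) ^ 2 ≤ 0.7 * (m * 0.7) := by
        have : (d - m) ^ 2 ≤ m * 0.7 := by nlinarith
        nlinarith [sq_nonneg (d - m)]
      have h6 : m * 1 ≤ m * R := mul_le_mul_of_nonneg_left (by linarith) (by linarith)
      nlinarith)
  have e1 := factorial_mul_choose_eq_prod hk
  have e2 := factorial_mul_multichoose_eq_prod p k
  rw [show m + (d - m) = d by ring, ← e1, ← hp, ← e2] at key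
  have hf : (0 : ℝ) < k.factorial := by exact_mod_cast k.factorial_pos
  have : (d.choose k : ℝ) ≤ 2 * p.multichoose k := by nlinarith
  exact_mod_cast this

/-- Evenness is needed because the binomial enters the difference with sign (-1)^k. The quantity
k(2s+1-k) = (s+1/2)² - (s+1/2-k)² peaks at k = s + 1/2, and an even k within distance 1 of the peak
loses at most 1. -/
lemma exists_even_two_mul_multichoose_lt_choose {n d p : ℕ} (hn : 2 ≤ n) (hpd : p + d = n)
    (hp0 : 0 < p)
    (h : ((n : ℝ) + 1) / 2 + √((⌊(n : ℝ) / 2⌋ : ℝ) * Real.log 2) < d) :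
    ∃ k, Even k ∧ 2 * p.multichoose k < d.choose k := by
  obtain ⟨ha1, -, ham⟩ := floor_half_bounds hn
  set a : ℝ := (⌊(n : ℝ) / 2⌋ : ℝ)
  set R := √(a * Real.log 2)
  set m : ℝ := (n : ℝ) / 2 with hm
  have hlog0 : 0 < Real.log 2 := Real.log_pos one_lt_two
  have hlog1 : Real.log 2 < 0.7 := Real.log_two_lt_d9.trans (by norm_num)
  have hR0 : 0 ≤ R := Real.sqrt_nonneg _
  have hR2 : R ^ 2 = a * Real.log 2 := Real.sq_sqrt (by positivity)
  have hRlog : Real.log 2 ≤ R := by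
    apply Real.le_sqrt_of_sq_le
    nlinarith
  have hn2 : (2 : ℝ) ≤ n := by exact_mod_cast hn
  have hp : (p : ℝ) = m - (d - m) := by
    have : (p : ℝ) + d = n := by exact_mod_cast hpd
    simp only [m]; linarith
  have hp0' : (0 : ℝ) < p := by exact_mod_cast hp0
  have hnd : n ≤ 2 * d := by
    have : (n : ℝ) ≤ 2 * d := by linarith
    exact_mod_cast this
  -- Dividing 2s + 2 by 4 gives s + 1/2 - 2q = (r-1)/2 ∈ [-1/2, 1] and 2q - 1 ≤ s, so k = 2q also
  -- keeps every s - i nonnegative.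
  obtain ⟨q, r, hr, hqr⟩ : ∃ q r : ℕ, r ≤ 3 ∧ 2 * d - n + 2 = 4 * q + r :=
    ⟨(2 * d - n + 2) / 4, (2 * d - n + 2) % 4, by omega, by omega⟩
  have hqr' : (2 * d - n + 2 : ℝ) = 4 * q + r := by
    have : 2 * d + 2 = 4 * q + r + n := by omega
    have : (2 * d + 2 : ℝ) = 4 * q + r + n := by exact_mod_cast this
    linarith
  have hs : (d : ℝ) - m = 2 * q + r / 2 - 1 := by rw [hm]; linarith
  have hr0 : (0 : ℝ) ≤ r := Nat.cast_nonneg r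
  have hr3 : (r : ℝ) ≤ 3 := by exact_mod_cast hr
  have key := two_mul_prod_lt_prod (m := m) (s := d - m) (by linarith) (by linarith) (k := 2 * q)
    (fun i hi ↦ by
      have : (i : ℝ) + 1 ≤ 2 * q := by exact_mod_cast Finset.mem_range.1 hi
      linarith) (by
      push_cast
      -- Since s + 1/2 > R + 1, after the loss of 1 there remains more than R² + 2R ≥ (a + 1) log 2
      -- ≥ m log 2.
      have h1 : (R + 1) ^ 2 < (d - m + 1 / 2) ^ 2 := by
        apply pow_lt_pow_left₀ <;> linarith
      have h2 : (d - m + 1 / 2 - 2 * q) ^ 2 ≤ 1 := by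
        rw [sq_le_one_iff_abs_le_one, abs_le]
        constructor <;> linarith
      have h3 : m * Real.log 2 ≤ (a + 1) * Real.log 2 :=
        mul_le_mul_of_nonneg_right ham.le hlog0.le
      have h4 : 2 * (q : ℝ) * (2 * (d - m) + 1 - 2 * q) =
          (d - m + 1 / 2) ^ 2 - (d - m + 1 / 2 - 2 * q) ^ 2 := by ring
      have h5 : (R + 1) ^ 2 = a * Real.log 2 + 2 * R + 1 := by rw [← hR2]; ring
      linarith)
  have hk : 2 * q ≤ d := by omega
  have e1 := factorial_mul_choose_eq_prod hk
  have e2 := factorial_mul_multichoose_eq_prod p (2 * q)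
  rw [show m + (d - m) = d by ring, ← e1, ← hp, ← e2] at key
  refine ⟨2 * q, even_two_mul q, ?_⟩
  have hf : (0 : ℝ) < (2 * q).factorial := by exact_mod_cast (2 * q).factorial_pos
  have : (2 * p.multichoose (2 * q) : ℝ) < d.choose (2 * q) := by nlinarith
  exact_mod_cast this

end Estimates

/-! ### The Hilbert function of the quotient by the edge ideal. -/

section QuotientHilbertFunction

open MvPolynomial

variable {K : Type u} [Field K]

lemma finrank_homogeneousSubmodule (n d : ℕ) :
    Module.finrank K (homogeneousSubmodule (Fin n) K d) = n.multichoose d := by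
  have hcard : Nat.card {P : Fin n →₀ ℕ // P.degree = d} = n.multichoose d := by
    rw [← Sym.card_sym_fin_eq_multichoose, ← Nat.card_eq_fintype_card]
    refine Nat.card_congr ((Equiv.subtypeEquivRight fun P ↦ ?_).trans
      (Sym.equivNatSum (Fin n) d).symm)
    rw [Finsupp.degree_eq_sum, Finsupp.sum_fintype _ _ fun _ ↦ rfl]
    rfl
  have : Finite {P : Fin n →₀ ℕ // P.degree = d} := by
    refine Finite.of_equiv (Sym (Fin n) d) ((Equiv.subtypeEquivRight fun P ↦ ?_).trans
      (Sym.equivNatSum (Fin n) d).symm).symm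
    rw [Finsupp.degree_eq_sum, Finsupp.sum_fintype _ _ fun _ ↦ rfl]
    rfl
  have : Fintype {P : Fin n →₀ ℕ // P.degree = d} := Fintype.ofFinite _
  let b : {P : Fin n →₀ ℕ // P.degree = d} → MvPolynomial (Fin n) K := fun P ↦ monomial P.1 1
  have hb : LinearIndependent K b := by
    have := (basisMonomials (Fin n) K).linearIndependent.comp
      (fun P : {P : Fin n →₀ ℕ // P.degree = d} ↦ P.1) Subtype.val_injective
    rwa [coe_basisMonomials] at this
  have hspan : homogeneousSubmodule (Fin n) K d = Submodule.span K (Set.range b) := by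
    apply le_antisymm
    · intro p hp
      rw [p.as_sum]
      refine Submodule.sum_mem _ fun m hm ↦ ?_
      rw [← mul_one (coeff m p), ← smul_eq_mul, ← smul_monomial]
      exact Submodule.smul_mem _ _ (Submodule.subset_span
        ⟨⟨m, by_contra fun h ↦ mem_support_iff.1 hm (hp.coeff_eq_zero h)⟩, rfl⟩)
    · rw [Submodule.span_le]
      rintro _ ⟨P, rfl⟩
      exact isHomogeneous_monomial _ P.2
  rw [hspan, finrank_span_eq_card hb, ← Nat.card_eq_fintype_card, hcard]

lemma finrank_submodule_prod {M N : Type*} [AddCommGroup M] [Module K M] [AddCommGroup N]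
    [Module K N] (p : Submodule K M) (q : Submodule K N) [Module.Finite K p] [Module.Finite K q] :
    Module.finrank K (p.prod q) = Module.finrank K p + Module.finrank K q := by
  have h : LinearMap.range (p.subtype.prodMap q.subtype) = p.prod q := by
    rw [LinearMap.range_prodMap, Submodule.range_subtype, Submodule.range_subtype]
  rw [← h, LinearMap.finrank_range_of_inj, Module.finrank_prod]
  exact Function.Injective.prodMap p.injective_subtype q.injective_subtype

variable (K) (n : ℕ)

/-- Setting `y = 0`. -/
noncomputable def evalLeft : MvPolynomial (Fin n ⊕ Fin n) K →ₐ[K] MvPolynomial (Fin n) K :=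
  aeval (Sum.elim X 0)

/-- Setting `x = 0`. -/
noncomputable def evalRight : MvPolynomial (Fin n ⊕ Fin n) K →ₐ[K] MvPolynomial (Fin n) K :=
  aeval (Sum.elim 0 X)

variable {K n}

lemma evalLeft_rename_inl (p : MvPolynomial (Fin n) K) :
    evalLeft K n (rename Sum.inl p) = p := by
  rw [evalLeft, aeval_rename, Sum.elim_comp_inl, aeval_X_left_apply]

lemma evalRight_rename_inr (p : MvPolynomial (Fin n) K) :
    evalRight K n (rename Sum.inr p) = p := by
  rw [evalRight, aeval_rename, Sum.elim_comp_inr, aeval_X_left_apply]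

lemma evalLeft_rename_inr (p : MvPolynomial (Fin n) K) :
    evalLeft K n (rename Sum.inr p) = C (constantCoeff p) := by
  rw [evalLeft, aeval_rename, Sum.elim_comp_inr, aeval_zero, algebraMap_eq]

lemma evalRight_rename_inl (p : MvPolynomial (Fin n) K) :
    evalRight K n (rename Sum.inl p) = C (constantCoeff p) := by
  rw [evalRight, aeval_rename, Sum.elim_comp_inl, aeval_zero, algebraMap_eq]

lemma constantCoeff_evalLeft (p : MvPolynomial (Fin n ⊕ Fin n) K) :
    constantCoeff (evalLeft K n p) = constantCoeff p := by
  induction p using MvPolynomial.induction_on with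
  | C a => simp [evalLeft]
  | add p q hp hq => simp only [map_add, hp, hq]
  | mul_X p i hp => cases i <;> simp [evalLeft]

lemma constantCoeff_evalRight (p : MvPolynomial (Fin n ⊕ Fin n) K) :
    constantCoeff (evalRight K n p) = constantCoeff p := by
  induction p using MvPolynomial.induction_on with
  | C a => simp [evalRight]
  | add p q hp hq => simp only [map_add, hp, hq]
  | mul_X p i hp => cases i <;> simp [evalRight]

lemma X_inl_mul_mem (i : Fin n) (p : MvPolynomial (Fin n) K) :
    X (Sum.inl i) * (rename Sum.inr p - C (constantCoeff p)) ∈ bipartiteEdgeIdeal K n n := by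
  induction p using MvPolynomial.induction_on with
  | C a => simp
  | add p q hp hq =>
    convert add_mem hp hq using 1
    simp only [map_add]
    ring
  | mul_X p j _ =>
    have h : X (Sum.inl i) * (rename Sum.inr (p * X j) - C (constantCoeff (p * X j))) =
        rename Sum.inr p * (X (Sum.inl i) * X (Sum.inr j) : MvPolynomial (Fin n ⊕ Fin n) K) := by
      simp only [map_mul, rename_X, constantCoeff_X, mul_zero, map_zero, sub_zero]
      ring
    rw [h]
    exact Ideal.mul_mem_left _ _ (Ideal.subset_span ⟨i, j, rfl⟩)

lemma X_inr_mul_mem (j : Fin n) (p : MvPolynomial (Fin n) K) :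
    X (Sum.inr j) * (rename Sum.inl p - C (constantCoeff p)) ∈ bipartiteEdgeIdeal K n n := by
  induction p using MvPolynomial.induction_on with
  | C a => simp
  | add p q hp hq =>
    convert add_mem hp hq using 1
    simp only [map_add]
    ring
  | mul_X p i _ =>
    have h : X (Sum.inr j) * (rename Sum.inl (p * X i) - C (constantCoeff (p * X i))) =
        rename Sum.inl p * (X (Sum.inl i) * X (Sum.inr j) : MvPolynomial (Fin n ⊕ Fin n) K) := by
      simp only [map_mul, rename_X, constantCoeff_X, mul_zero, map_zero, sub_zero]
      ring
    rw [h]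
    exact Ideal.mul_mem_left _ _ (Ideal.subset_span ⟨i, j, rfl⟩)

/-- Modulo the edge ideal, a polynomial is determined by its restrictions to the two coordinate
subspaces. -/
lemma sub_mem_bipartiteEdgeIdeal (p : MvPolynomial (Fin n ⊕ Fin n) K) :
    p - (rename Sum.inl (evalLeft K n p) + rename Sum.inr (evalRight K n p) -
      C (constantCoeff p)) ∈ bipartiteEdgeIdeal K n n := by
  induction p using MvPolynomial.induction_on with
  | C a => simp [evalLeft, evalRight]
  | add p q hp hq =>
    convert add_mem hp hq using 1
    simp only [map_add]
    ring
  | mul_X p i hp =>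
    rcases i with i | j
    · have h := add_mem (Ideal.mul_mem_right (X (Sum.inl i)) _ hp)
        (X_inl_mul_mem i (evalRight K n p))
      have e1 : evalLeft K n (X (Sum.inl i)) = X i := by simp [evalLeft]
      have e2 : evalRight K n (X (Sum.inl i)) = 0 := by simp [evalRight]
      convert h using 1
      rw [map_mul (evalLeft K n), map_mul (evalRight K n), e1, e2, constantCoeff_evalRight]
      simp only [map_mul, rename_X, constantCoeff_X, mul_zero, map_zero]
      ring
    · have h := add_mem (Ideal.mul_mem_right (X (Sum.inr j)) _ hp)
        (X_inr_mul_mem j (evalLeft K n p))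
      have e1 : evalLeft K n (X (Sum.inr j)) = 0 := by simp [evalLeft]
      have e2 : evalRight K n (X (Sum.inr j)) = X j := by simp [evalRight]
      convert h using 1
      rw [map_mul (evalLeft K n), map_mul (evalRight K n), e1, e2, constantCoeff_evalLeft]
      simp only [map_mul, rename_X, constantCoeff_X, mul_zero, map_zero]
      ring

variable (K n)

/-- The quotient by the edge ideal embeds into the product of the coordinate rings of the two
coordinate subspaces. -/
noncomputable def quotientToProd : (MvPolynomial (Fin n ⊕ Fin n) K ⧸ bipartiteEdgeIdeal K n n) →ₐ[K]
    MvPolynomial (Fin n) K × MvPolynomial (Fin n) K :=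
  Ideal.Quotient.liftₐ _ ((evalLeft K n).prod (evalRight K n)) (by
    have : bipartiteEdgeIdeal K n n ≤
        RingHom.ker ((evalLeft K n).prod (evalRight K n) : _ →ₐ[K] _) := by
      rw [bipartiteEdgeIdeal, Ideal.span_le]
      rintro _ ⟨i, j, rfl⟩
      simp [evalLeft, evalRight, RingHom.mem_ker]
    exact fun p hp ↦ this hp)

lemma quotientToProd_mk (p : MvPolynomial (Fin n ⊕ Fin n) K) :
    quotientToProd K n (Ideal.Quotient.mkₐ K _ p) = (evalLeft K n p, evalRight K n p) := rfl

lemma quotientToProd_injective : Function.Injective (quotientToProd K n) := by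
  rw [injective_iff_map_eq_zero]
  intro x hx
  obtain ⟨p, rfl⟩ := Ideal.Quotient.mkₐ_surjective K _ x
  rw [quotientToProd_mk, Prod.mk_eq_zero] at hx
  have h := sub_mem_bipartiteEdgeIdeal p
  have hc : constantCoeff p = 0 := by
    rw [← constantCoeff_evalLeft, hx.1, map_zero]
  rw [hx.1, hx.2, hc] at h
  simp only [map_zero, add_zero, sub_zero] at h
  exact Ideal.Quotient.eq_zero_iff_mem.2 h

/-- The Hilbert function of the quotient by the edge ideal of `K_{n,n}`. -/
theorem hilbertFunction_quotientGrading (i : ℤ) :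
    (hilbertFunction (quotientGrading (bipartiteEdgeIdeal K n n)) i : ℤ) =
      2 * polyHilbert n i - polyHilbert 0 i := by
  rcases i with d | d
  swap
  · rw [polyHilbert_of_neg _ (Int.negSucc_lt_zero d), polyHilbert_of_neg _ (Int.negSucc_lt_zero d)]
    change ((Module.finrank K (⊥ : Submodule K _) : ℕ) : ℤ) = _
    simp
  let e := Submodule.equivMapOfInjective (quotientToProd K n).toLinearMap
    (quotientToProd_injective K n)
    ((homogeneousSubmodule (Fin n ⊕ Fin n) K d).map
      (Ideal.Quotient.mkₐ K (bipartiteEdgeIdeal K n n)).toLinearMap)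
  have hfin : hilbertFunction (quotientGrading (bipartiteEdgeIdeal K n n)) (Int.ofNat d) =
      Module.finrank K ((homogeneousSubmodule (Fin n ⊕ Fin n) K d).map
        ((evalLeft K n).toLinearMap.prod (evalRight K n).toLinearMap)) := by
    refine e.finrank_eq.trans ?_
    rw [← Submodule.map_comp]
    rfl
  rw [hfin, Int.ofNat_eq_natCast, polyHilbert_natCast, polyHilbert_zero]
  rcases d.eq_zero_or_pos with rfl | hd
  -- In degree zero the image in the product is only the line through (1, 1); this accounts for the
  -- term -1 in the series.
  · rw [homogeneousSubmodule_zero, Submodule.one_eq_span, Submodule.map_span, Set.image_singleton,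
      finrank_span_singleton]
    · simp
    · simp [Prod.mk_eq_zero]
  -- In positive degree constant terms vanish, so the two restrictions can be prescribed
  -- independently.
  · have hmap : (homogeneousSubmodule (Fin n ⊕ Fin n) K d).map
        ((evalLeft K n).toLinearMap.prod (evalRight K n).toLinearMap) =
        (homogeneousSubmodule (Fin n) K d).prod (homogeneousSubmodule (Fin n) K d) := by
      have hconst : ∀ a ∈ homogeneousSubmodule (Fin n) K d, constantCoeff a = 0 := by
        intro a ha
        exact IsHomogeneous.coeff_eq_zero ha (by simpa using hd.ne)
      apply le_antisymm
      · rintro _ ⟨p, hp, rfl⟩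
        have hl : (evalLeft K n p).IsHomogeneous (1 * d) := hp.aeval _ (by
          rintro (i | j)
          · exact isHomogeneous_X _ _
          · exact isHomogeneous_zero _ _ _)
        have hr : (evalRight K n p).IsHomogeneous (1 * d) := hp.aeval _ (by
          rintro (i | j)
          · exact isHomogeneous_zero _ _ _
          · exact isHomogeneous_X _ _)
        rw [one_mul] at hl hr
        exact ⟨hl, hr⟩
      · rintro ⟨a, b⟩ ⟨ha, hb⟩
        refine ⟨rename Sum.inl a + rename Sum.inr b,
          IsHomogeneous.add (IsHomogeneous.rename_isHomogeneous ha)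
            (IsHomogeneous.rename_isHomogeneous hb), ?_⟩
        refine Prod.ext ?_ ?_
        · change evalLeft K n _ = a
          rw [map_add, evalLeft_rename_inl, evalLeft_rename_inr, hconst b hb, map_zero, add_zero]
        · change evalRight K n _ = b
          rw [map_add, evalRight_rename_inl, evalRight_rename_inr, hconst a ha, map_zero, zero_add]
    have : Module.Finite K (homogeneousSubmodule (Fin n) K d) :=
      Module.Finite.iff_fg.2 (homogeneousSubmodule_fg (Fin n) K d)
    rw [hmap, finrank_submodule_prod, finrank_homogeneousSubmodule, if_neg (by omega)]
    push_cast
    ring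

end QuotientHilbertFunction

/-! ### Weak regularity of products and of sequences of variables. -/

section WeaklyRegular

open MvPolynomial RingTheory.Sequence

lemma mem_ideal_smul_top_prod {R M N : Type*} [CommRing R] [AddCommGroup M] [Module R M]
    [AddCommGroup N] [Module R N] (I : Ideal R) (x : M × N) :
    x ∈ I • (⊤ : Submodule R (M × N)) ↔
      x.1 ∈ I • (⊤ : Submodule R M) ∧ x.2 ∈ I • (⊤ : Submodule R N) := by
  constructor
  · intro hx
    refine ⟨?_, ?_⟩
    · have := Submodule.mem_map_of_mem (f := LinearMap.fst R M N) hx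
      rw [Submodule.map_smul''] at this
      exact Submodule.smul_mono (le_refl I) le_top this
    · have := Submodule.mem_map_of_mem (f := LinearMap.snd R M N) hx
      rw [Submodule.map_smul''] at this
      exact Submodule.smul_mono (le_refl I) le_top this
  · rintro ⟨h1, h2⟩
    have h1' := Submodule.mem_map_of_mem (f := LinearMap.inl R M N) h1
    have h2' := Submodule.mem_map_of_mem (f := LinearMap.inr R M N) h2
    rw [Submodule.map_smul''] at h1' h2'
    have := add_mem (Submodule.smul_mono (le_refl I) le_top h1')
      (Submodule.smul_mono (le_refl I) le_top h2')
    simpa using this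

lemma _root_.RingTheory.Sequence.IsWeaklyRegular.prod {R M N : Type*} [CommRing R] [AddCommGroup M]
    [Module R M] [AddCommGroup N] [Module R N] {rs : List R} (hM : IsWeaklyRegular M rs)
    (hN : IsWeaklyRegular N rs) : IsWeaklyRegular (M × N) rs := by
  refine ⟨fun i hi ↦ ?_⟩
  have h1 := hM.regular_mod_prev i hi
  have h2 := hN.regular_mod_prev i hi
  rw [isSMulRegular_quotient_iff_mem_of_smul_mem] at h1 h2 ⊢
  intro x hx
  rw [mem_ideal_smul_top_prod] at hx ⊢
  exact ⟨h1 _ hx.1, h2 _ hx.2⟩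

/-- Distinct variables form a regular sequence. -/
lemma isWeaklyRegular_map_X {τ : Type*} (K : Type*) [Field K] {l : List τ} (hl : l.Nodup) :
    IsWeaklyRegular (MvPolynomial τ K) (l.map (X : τ → MvPolynomial τ K)) := by
  induction l using List.reverseRecOn with
  | nil => exact .nil _ _
  | append_singleton l a ih =>
    rw [List.nodup_append] at hl
    rw [List.map_append, isWeaklyRegular_append_iff]
    refine ⟨ih hl.1, ?_⟩
    rw [List.map_singleton, isWeaklyRegular_singleton_iff,
      isSMulRegular_quotient_iff_mem_of_smul_mem]
    have hI : (Ideal.ofList (l.map (X : τ → MvPolynomial τ K)) • ⊤ : Ideal (MvPolynomial τ K)) =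
        Ideal.span ((X : τ → MvPolynomial τ K) '' {i | i ∈ l}) := by
      rw [smul_eq_mul, Ideal.mul_top, Ideal.ofList]
      congr 1
      ext p
      simp
    rw [hI]
    intro p hp
    rw [mem_ideal_span_X_image] at hp ⊢
    intro m hm
    -- Multiplication by X_a shifts the support by one in position a. As a is not in `l`, the
    -- variable of `l` dividing the shifted monomial already divides the original one.
    obtain ⟨i, hi, him⟩ := hp (m + Finsupp.single a 1) (by
      rw [mem_support_iff, smul_eq_mul, mul_comm, coeff_mul_X]
      exact mem_support_iff.1 hm)
    refine ⟨i, hi, ?_⟩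
    have hai : a ≠ i := fun h ↦ hl.2.2 i hi a (by simp) h.symm
    simpa [Finsupp.single_apply, hai] using him

end WeaklyRegular

/-! ### Modules realizing prescribed Hilbert functions. -/

section Realization

open MvPolynomial RingTheory.Sequence

variable (K : Type u) [Field K] (n : ℕ)

/-- `f` is the Hilbert function of a finitely generated graded module on which `rs` is a weakly
regular sequence. -/
def IsRealized (σ : Type) (rs : List (MvPolynomial σ K)) (f : ℤ → ℤ) : Prop :=
  ∃ (N : Type u) (_ : AddCommGroup N) (_ : Module K N)
    (_ : Module (MvPolynomial σ K) N) (_ : IsScalarTower K (MvPolynomial σ K) N)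
    (𝒩 : ℤ → Submodule K N),
    Module.Finite (MvPolynomial σ K) N ∧ IsGrading σ 𝒩 ∧
    (∀ i, (hilbertFunction 𝒩 i : ℤ) = f i) ∧ IsWeaklyRegular N rs

variable {K n} {σ : Type} {rs : List (MvPolynomial σ K)}

lemma isRealized_zero : IsRealized K σ rs 0 := by
  refine ⟨PUnit, inferInstance, inferInstance, inferInstance, inferInstance, fun _ ↦ ⊥,
    inferInstance, ⟨IsProjections.isInternal (π := 0)
      ⟨fun _ _ ↦ Subsingleton.elim _ _, fun _ _ _ ↦ Subsingleton.elim _ _,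
        fun _ _ _ _ _ ↦ Subsingleton.elim _ _, Subsingleton.elim _ _⟩,
      fun _ _ _ _ _ _ ↦ Subsingleton.elim _ _⟩, fun i ↦ ?_, ⟨fun i hi ↦ ?_⟩⟩
  · simp [hilbertFunction]
  · exact fun _ _ _ ↦ Subsingleton.elim _ _

lemma IsRealized.add [Finite σ] {f g : ℤ → ℤ} (hf : IsRealized K σ rs f)
    (hg : IsRealized K σ rs g) : IsRealized K σ rs (f + g) := by
  obtain ⟨M, _, _, _, _, ℳ, _, hℳ, hf, hM⟩ := hf
  obtain ⟨N, _, _, _, _, 𝒩, _, h𝒩, hg, hN⟩ := hg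
  obtain ⟨π, hπ⟩ := exists_isProjections hℳ.isInternal
  obtain ⟨ρ, hρ⟩ := exists_isProjections h𝒩.isInternal
  refine ⟨M × N, inferInstance, inferInstance, inferInstance, inferInstance,
    fun i ↦ (ℳ i).prod (𝒩 i), inferInstance,
    ⟨IsProjections.isInternal (π := fun i ↦ (π i).prodMap (ρ i)) ⟨?_, ?_, ?_, ?_⟩, ?_⟩, ?_,
    hM.prod hN⟩
  · exact fun i x ↦ ⟨hπ.mem i x.1, hρ.mem i x.2⟩
  · exact fun i x hx ↦ Prod.ext (hπ.same i _ hx.1) (hρ.same i _ hx.2)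
  · exact fun i j x hx hij ↦ Prod.ext (hπ.ne i j _ hx.1 hij) (hρ.ne i j _ hx.2 hij)
  · rw [eq_top_iff]
    have h1 : (⊤ : Submodule K M).map (LinearMap.inl K M N) ≤ ⨆ i, (ℳ i).prod (𝒩 i) := by
      rw [← hπ.top, Submodule.map_iSup]
      refine iSup_mono fun i ↦ ?_
      rintro _ ⟨x, hx, rfl⟩
      exact ⟨hx, (𝒩 i).zero_mem⟩
    have h2 : (⊤ : Submodule K N).map (LinearMap.inr K M N) ≤ ⨆ i, (ℳ i).prod (𝒩 i) := by
      rw [← hρ.top, Submodule.map_iSup]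
      refine iSup_mono fun i ↦ ?_
      rintro _ ⟨x, hx, rfl⟩
      exact ⟨(ℳ i).zero_mem, hx⟩
    rintro ⟨x, y⟩ -
    have := add_mem (h1 ⟨x, trivial, rfl⟩) (h2 ⟨y, trivial, rfl⟩)
    simpa using this
  · exact fun d i p x hp hx ↦ ⟨hℳ.smul_mem d i p _ hp hx.1, h𝒩.smul_mem d i p _ hp hx.2⟩
  · intro i
    have := hℳ.finite_piece i
    have := h𝒩.finite_piece i
    rw [hilbertFunction, finrank_submodule_prod, Pi.add_apply, ← hf, ← hg]
    exact Nat.cast_add _ _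

/-- The first `d` of the variables `x_1, …, x_n`. -/
noncomputable def firstVars (K : Type u) [Field K] {n d : ℕ} (h : d ≤ n) :
    List (MvPolynomial (Fin n ⊕ Fin n) K) :=
  (List.ofFn (Fin.castLE h)).map fun i ↦ X (Sum.inl i)

/-- The projection onto the polynomial ring in the first `j` variables. -/
noncomputable def projFirst (K : Type u) [Field K] (n j : ℕ) :
    MvPolynomial (Fin n ⊕ Fin n) K →ₐ[K] MvPolynomial (Fin j) K :=
  aeval (Sum.elim (fun i ↦ if h : (i : ℕ) < j then X ⟨i, h⟩ else 0) 0)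

lemma projFirst_surjective {n j : ℕ} (h : j ≤ n) : Function.Surjective (projFirst K n j) := by
  intro p
  refine ⟨rename (fun i ↦ Sum.inl (Fin.castLE h i)) p, ?_⟩
  rw [projFirst, aeval_rename]
  have h' : Sum.elim (fun i : Fin n ↦ if h : (i : ℕ) < j then
      (X ⟨i, h⟩ : MvPolynomial (Fin j) K) else 0) (0 : Fin n → _) ∘
        (fun i ↦ Sum.inl (Fin.castLE h i)) = X := by
    ext1 i
    simp
  rw [h', aeval_X_left_apply]

/-- The grading of the polynomial ring shifted by `k`. -/
noncomputable def shiftedGrading (K : Type u) [Field K] (τ : Type) (k i : ℤ) :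
    Submodule K (MvPolynomial τ K) :=
  if k ≤ i then homogeneousSubmodule τ K (i - k).toNat else ⊥

lemma isProjections_shiftedGrading (τ : Type) (k : ℤ) :
    IsProjections (shiftedGrading K τ k)
      fun i ↦ if k ≤ i then homogeneousComponent (i - k).toNat else 0 := by
  refine ⟨fun i x ↦ ?_, fun i x hx ↦ ?_, fun i j x hx hij ↦ ?_, ?_⟩
  · rw [shiftedGrading]
    split_ifs
    · exact homogeneousComponent_mem _ _
    · exact Submodule.zero_mem _
  · rw [shiftedGrading] at hx
    split_ifs at hx ⊢
    · rw [homogeneousComponent_of_mem hx, if_pos rfl]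
    · exact ((Submodule.mem_bot K).1 hx).symm
  · rw [shiftedGrading] at hx
    by_cases hj : k ≤ j
    · rw [if_pos hj]
      split_ifs at hx
      · rw [homogeneousComponent_of_mem hx, if_neg (by omega)]
      · rw [(Submodule.mem_bot K).1 hx, map_zero]
    · rw [if_neg hj, LinearMap.zero_apply]
  · rw [eq_top_iff]
    intro p _
    rw [← sum_homogeneousComponent p]
    refine Submodule.sum_mem _ fun d _ ↦ Submodule.mem_iSup_of_mem (k + d) ?_
    rw [shiftedGrading, if_pos (by omega), show (k + d - k).toNat = d by omega]
    exact homogeneousComponent_mem _ _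

/-- The module is K[x_1, …, x_j], a quotient of the big ring because j ≤ n, with its generator in
degree k. As d ≤ j, the first d variables survive in it as distinct variables. -/
lemma isRealized_polyHilbert {n d j : ℕ} (hd : d ≤ n) (hdj : d ≤ j) (hj : j ≤ n) (k : ℕ) :
    IsRealized K (Fin n ⊕ Fin n) (firstVars K hd) fun i ↦ polyHilbert j (i - k) := by
  let _ : Algebra (MvPolynomial (Fin n ⊕ Fin n) K) (MvPolynomial (Fin j) K) :=
    (projFirst K n j).toRingHom.toAlgebra
  have hsmul : ∀ (p : MvPolynomial (Fin n ⊕ Fin n) K) (x : MvPolynomial (Fin j) K),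
      p • x = projFirst K n j p * x := fun p x ↦ rfl
  have : IsScalarTower K (MvPolynomial (Fin n ⊕ Fin n) K) (MvPolynomial (Fin j) K) :=
    IsScalarTower.of_algebraMap_eq fun a ↦ ((projFirst K n j).commutes a).symm
  have hG : IsGrading (Fin n ⊕ Fin n) (shiftedGrading K (Fin j) k) := by
    refine ⟨(isProjections_shiftedGrading (Fin j) k).isInternal, fun d i p x hp hx ↦ ?_⟩
    rw [hsmul]
    rw [shiftedGrading] at hx ⊢
    split_ifs at hx with hi
    · rw [if_pos (by omega), show (i + d - k).toNat = d + (i - k).toNat by omega]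
      refine IsHomogeneous.mul ?_ hx
      have := IsHomogeneous.aeval hp
        (Sum.elim (fun i : Fin n ↦ if h : (i : ℕ) < j then (X ⟨i, h⟩ : MvPolynomial (Fin j) K)
          else 0) (0 : Fin n → MvPolynomial (Fin j) K)) (n := 1) (by
        rintro (i | i)
        · simp only [Sum.elim_inl]
          split_ifs
          · exact isHomogeneous_X _ _
          · exact isHomogeneous_zero _ _ _
        · exact isHomogeneous_zero _ _ _)
      rwa [one_mul] at this
    · rw [(Submodule.mem_bot K).1 hx, mul_zero]
      exact Submodule.zero_mem _
  refine ⟨MvPolynomial (Fin j) K, inferInstance, inferInstance, inferInstance, inferInstance,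
    shiftedGrading K (Fin j) k, ?_, hG, fun i ↦ ?_, ?_⟩
  · exact Module.Finite.of_surjective
      (Algebra.linearMap (MvPolynomial (Fin n ⊕ Fin n) K) (MvPolynomial (Fin j) K))
      (projFirst_surjective hj)
  · change (Module.finrank K (shiftedGrading K (Fin j) k i) : ℤ) = polyHilbert j (i - k)
    by_cases hi : (k : ℤ) ≤ i
    · have h : shiftedGrading K (Fin j) k i = _ := if_pos hi
      rw [h, finrank_homogeneousSubmodule, polyHilbert, if_neg (by omega)]
    · have h : shiftedGrading K (Fin j) k i = _ := if_neg hi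
      rw [h, polyHilbert_of_neg _ (by omega), finrank_bot, Nat.cast_zero]
  · rw [← isWeaklyRegular_map_algebraMap_iff (MvPolynomial (Fin j) K)]
    have hmap : (firstVars K hd).map (algebraMap _ (MvPolynomial (Fin j) K)) =
        (List.ofFn (Fin.castLE hdj)).map (X : Fin j → MvPolynomial (Fin j) K) := by
      rw [firstVars, List.map_map, List.map_ofFn, List.map_ofFn]
      congr 1
      ext1 i
      change projFirst K n j (X (Sum.inl _)) = X _
      rw [projFirst, aeval_X, Sum.elim_inl, dif_pos (by simp; omega)]
      rfl
    rw [hmap]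
    exact isWeaklyRegular_map_X K (List.nodup_ofFn.2 (Fin.castLE_injective hdj))

lemma isRealized_of_mem_freeHilbert {n d : ℕ} (hd : d ≤ n) {f : ℤ → ℤ}
    (hf : f ∈ freeHilbert d n) : IsRealized K (Fin n ⊕ Fin n) (firstVars K hd) f := by
  induction hf using AddSubmonoid.closure_induction with
  | mem f hf =>
    obtain ⟨j, k, hj, hj', rfl⟩ := hf
    exact isRealized_polyHilbert hd hj hj' k
  | zero => exact isRealized_zero
  | add f g _ _ hf hg => exact hf.add hg

end Realization

/-! ### From regular sequences to bounds on the Hilbert depth. -/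

section Depth

open MvPolynomial RingTheory.Sequence

lemma HasRegularSeq.mono {R M : Type*} [CommRing R] [AddCommGroup M] [Module R M] {𝔪 : Ideal R}
    {d d' : ℕ} (h : HasRegularSeq 𝔪 M d) (hd : d' ≤ d) : HasRegularSeq 𝔪 M d' := by
  obtain ⟨rs, hl, hm, hr⟩ := h
  refine ⟨rs.take d', by simp [hl, hd], fun r hr ↦ hm r (List.mem_of_mem_take hr), ?_⟩
  rw [← List.take_append_drop d' rs, isWeaklyRegular_append_iff] at hr
  exact hr.1

/-- A graded version of Nakayama's lemma: the elements of lowest degree are not in the submodule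
generated by the multiples of the variables. -/
lemma IsGrading.idealOfVars_smul_top_ne_top {σ : Type v} {K : Type u} [Field K] [Finite σ]
    {M : Type w} [AddCommGroup M] [Module K M] [Module (MvPolynomial σ K) M]
    [IsScalarTower K (MvPolynomial σ K) M] [Module.Finite (MvPolynomial σ K) M]
    {ℳ : ℤ → Submodule K M} (hℳ : IsGrading σ ℳ) {i : ℤ} (h0 : hilbertFunction ℳ (i - 1) = 0)
    (h1 : hilbertFunction ℳ i ≠ 0) :
    idealOfVars σ K • (⊤ : Submodule (MvPolynomial σ K) M) ≠ ⊤ := by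
  obtain ⟨π, hπ⟩ := exists_isProjections hℳ.isInternal
  have := hℳ.finite_piece (i - 1)
  have hbot : ℳ (i - 1) = ⊥ := Submodule.finrank_eq_zero.1 h0
  -- A variable sends only degree i - 1 into degree i, and M_{i-1} = 0.
  have hsmul : ∀ r ∈ idealOfVars σ K, ∀ x : M, π i (r • x) = 0 := by
    intro r hr
    induction hr using Submodule.span_induction with
    | mem r hr =>
      obtain ⟨s, rfl⟩ := hr
      intro x
      have hx := hπ.mem (i - 1) x
      rw [hbot, Submodule.mem_bot] at hx
      rw [hπ.smul_of_degree_one hℳ (isHomogeneous_X K s), hx, smul_zero]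
    | zero => simp
    | add r s _ _ hr hs => intro x; rw [add_smul, map_add, hr, hs, add_zero]
    | smul a r _ hr => intro x; rw [smul_eq_mul, mul_comm, mul_smul, hr]
  have hzero : ∀ x ∈ idealOfVars σ K • (⊤ : Submodule (MvPolynomial σ K) M), π i x = 0 := by
    intro x hx
    induction hx using Submodule.smul_induction_on' with
    | smul r hr y _ => exact hsmul r hr y
    | add y _ z _ hy hz => rw [map_add, hy, hz, add_zero]
  intro htop
  have hbot' : ℳ i = ⊥ := (Submodule.eq_bot_iff _).2 fun x hx ↦ by
    rw [← hπ.same i x hx]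
    exact hzero x (by rw [htop]; trivial)
  exact h1 (by rw [hilbertFunction, hbot', finrank_bot])

lemma hasRegularSeq_length_le {K : Type u} [Field K] {n d : ℕ} (hn : 2 ≤ n)
    {N : Type w} [AddCommGroup N] [Module K N]
    [Module (MvPolynomial (Fin n ⊕ Fin n) K) N] [IsScalarTower K (MvPolynomial (Fin n ⊕ Fin n) K) N]
    [Module.Finite (MvPolynomial (Fin n ⊕ Fin n) K) N] {𝒩 : ℤ → Submodule K N}
    (h𝒩 : IsGrading (Fin n ⊕ Fin n) 𝒩)
    (hH : hilbertFunction 𝒩 = hilbertFunction (quotientGrading (bipartiteEdgeIdeal K n n)))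
    (h : HasRegularSeq (idealOfVars (Fin n ⊕ Fin n) K) N d) :
    (d : ℝ) ≤ ((n : ℝ) + 1) / 2 + √((⌊(n : ℝ) / 2⌋ : ℝ) * Real.log 2) := by
  have hnonneg : ∀ d', d' ≤ d → d' ≤ n → ∀ k : ℕ,
      0 ≤ 2 * ((n - d').multichoose k : ℤ) - (-1) ^ k * d'.choose k := by
    intro d' hd' hd'n k
    have h1 := (h.mono hd').iterate_backwardDiff_nonneg h𝒩 k
    have h2 : (fun i ↦ (hilbertFunction 𝒩 i : ℤ)) =
        fun i ↦ 2 * polyHilbert (n - d' + d') i - polyHilbert 0 i := by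
      ext i
      rw [hH, hilbertFunction_quotientGrading, Nat.sub_add_cancel hd'n]
    rw [h2, iterate_backwardDiff_two_mul_sub, iterate_backwardDiff_polyHilbert] at h1
    simp only at h1
    rwa [polyHilbert_natCast, iterate_backwardDiff_polyHilbert_zero] at h1
  by_contra! hlt
  rcases lt_or_ge d n with hdn | hdn
  · obtain ⟨k, hk, hlt'⟩ := exists_even_two_mul_multichoose_lt_choose hn
      (Nat.sub_add_cancel hdn.le) (by omega) hlt
    have := hnonneg d le_rfl hdn.le k
    rw [hk.neg_one_pow] at this
    omega
  -- When d ≥ n the sequence is cut to length n. No variables remain, and the coefficient in degree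
  -- 2 is -choose(n, 2) < 0.
  · have := hnonneg n hdn le_rfl 2
    rw [Nat.sub_self, Nat.multichoose_zero_succ] at this
    have hpos : 0 < n.choose 2 := Nat.choose_pos hn
    norm_num at this
    omega

lemma h_le {K : Type u} [Field K] {n B : ℕ} (hn : 2 ≤ n)
    (hB : ((n : ℝ) + 1) / 2 + √((⌊(n : ℝ) / 2⌋ : ℝ) * Real.log 2) < B + 1) :
    h K n n ≤ B := by
  refine sSup_le ?_
  rintro _ ⟨N, _, _, _, _, 𝒩, _, h𝒩, hH, rfl⟩
  refine sSup_le ?_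
  rintro _ ⟨rs, hm, hr, rfl⟩
  have := hasRegularSeq_length_le hn h𝒩 hH ⟨rs, rfl, hm, hr.toIsWeaklyRegular⟩
  have h2 : (rs.length : ℝ) < (B + 1 : ℕ) := by push_cast; linarith
  exact_mod_cast Nat.lt_succ_iff.1 (by exact_mod_cast h2)

lemma le_h {K : Type u} [Field K] {n d : ℕ} (hn : 2 ≤ n) (hdn : d ≤ n)
    (hd : (d : ℝ) ≤ (n : ℝ) / 2 + √((⌊(n : ℝ) / 2⌋ : ℝ) * Real.log 2) - 1) :
    (d : ℕ∞) ≤ h K n n := by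
  have hmem := two_mul_polyHilbert_sub_mem_freeHilbert
    (choose_le_two_mul_multichoose hn (Nat.sub_add_cancel hdn) hd)
  rw [Nat.sub_add_cancel hdn] at hmem
  obtain ⟨N, _, _, _, _, 𝒩, _, h𝒩, hH, hreg⟩ :=
    isRealized_of_mem_freeHilbert (K := K) hdn hmem
  have hle : (d : ℕ∞) ≤ depth (Fin n ⊕ Fin n) K N := by
    have hvars : ∀ r ∈ firstVars K hdn, r ∈ idealOfVars (Fin n ⊕ Fin n) K := by
      intro r hr
      obtain ⟨i, -, rfl⟩ := List.mem_map.1 hr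
      exact Ideal.subset_span ⟨_, rfl⟩
    -- Weak regularity becomes regularity by graded Nakayama in degree 0, the lowest nonzero degree.
    refine le_sSup ⟨firstVars K hdn, hvars, ⟨hreg, fun htop ↦ ?_⟩, by simp [firstVars]⟩
    refine h𝒩.idealOfVars_smul_top_ne_top (i := 0) ?_ ?_ ?_
    · have := hH (0 - 1)
      simp only at this
      rw [polyHilbert_of_neg _ (by simp), polyHilbert_of_neg _ (by simp), mul_zero, sub_zero] at this
      exact Int.natCast_eq_zero.1 this
    · have := hH 0
      intro h0
      simp [h0, polyHilbert] at this
    · have hI : Ideal.ofList (firstVars K hdn) ≤ idealOfVars (Fin n ⊕ Fin n) K :=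
        Ideal.span_le.2 hvars
      exact top_le_iff.1 (htop.le.trans (Submodule.smul_mono hI le_rfl))
  refine hle.trans (le_sSup ⟨N, inferInstance, inferInstance, inferInstance, inferInstance, 𝒩,
    inferInstance, h𝒩, ?_, rfl⟩)
  ext i
  have := (hH i).trans (hilbertFunction_quotientGrading K n i).symm
  exact_mod_cast this

end Depth

end HilbertDepth

theorem theorem3p2 (K : Type u) [Field K] (n : ℕ) (hn : 2 ≤ n) :
    ∃ h : ℕ, HilbertDepth.h K n n = (h : ℕ∞) ∧
      ⌊(n : ℝ) / 2 + √((⌊(n : ℝ) / 2⌋ : ℝ) * Real.log 2)⌋ - 1 ≤ (h : ℤ) ∧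
      (h : ℤ) ≤ ⌊((n : ℝ) + 1) / 2 + √((⌊(n : ℝ) / 2⌋ : ℝ) * Real.log 2)⌋ := by
  obtain ⟨ha1, ham, -⟩ := HilbertDepth.floor_half_bounds hn
  have hlog0 : 0 < Real.log 2 := Real.log_pos one_lt_two
  have hlog1 : Real.log 2 < 1 := Real.log_two_lt_d9.trans (by norm_num)
  set R := √((⌊(n : ℝ) / 2⌋ : ℝ) * Real.log 2)
  have hR0 : 0 ≤ R := Real.sqrt_nonneg _
  have hn2 : (2 : ℝ) ≤ n := by exact_mod_cast hn
  have hRn : R ≤ (n : ℝ) / 2 := by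
    refine Real.sqrt_le_iff.2 ⟨by positivity, ?_⟩
    nlinarith
  obtain ⟨B, hB⟩ := Int.eq_ofNat_of_zero_le
    (Int.floor_nonneg.2 (by positivity : 0 ≤ ((n : ℝ) + 1) / 2 + R))
  obtain ⟨d, hd⟩ := Int.eq_ofNat_of_zero_le (a := ⌊(n : ℝ) / 2 + R⌋ - 1) (by
    have : 1 ≤ ⌊(n : ℝ) / 2 + R⌋ := Int.le_floor.2 (by push_cast; linarith)
    omega)
  have hle : HilbertDepth.h K n n ≤ B := HilbertDepth.h_le hn (by
    have := Int.lt_floor_add_one (((n : ℝ) + 1) / 2 + R)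
    rwa [hB] at this)
  have hd' : (d : ℝ) ≤ (n : ℝ) / 2 + R - 1 := by
    have h1 := Int.floor_le ((n : ℝ) / 2 + R)
    have h2 : ((⌊(n : ℝ) / 2 + R⌋ - 1 : ℤ) : ℝ) = d := by rw [hd]; simp
    push_cast at h2
    linarith
  have hdn : d ≤ n := by
    have : (d : ℝ) ≤ n := by linarith
    exact_mod_cast this
  have hge := HilbertDepth.le_h (K := K) hn hdn hd'
  -- The upper bound also shows that the extended natural number is finite.
  obtain ⟨k, hk⟩ := ENat.ne_top_iff_exists.1 (ne_top_of_le_ne_top (ENat.natCast_ne_top B) hle)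
  rw [← hk] at hle hge
  refine ⟨k, hk.symm, ?_, ?_⟩
  · rw [hd]; exact_mod_cast hge
  · rw [hB]; exact_mod_cast hle
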